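/- Let $X$ be a rack, that is, a set (possibly empty) with a binary operation $\rhd$ such that $y\mapsto x\rhd y$ is an automorphism of $(X,\rhd)$ for every $x\in X$, and let $A$ be an abelian group. The rack cohomology $\mathrm{HR}^n(X;A)$ is the $n$-th cohomology of the cochain complex $\mathrm{Hom}(\mathrm{CR}_\bullet(X),A)$. Here $\mathrm{CR}_n(X)$ is the free abelian group with basis $X^n$, with differential $\mathrm{CR}_n(X)\to\mathrm{CR}_{n-1}(X)$ given by \[ \delta(x_1,\dots,x_n)=\sum_{j=1}^{n}(-1)^j\bigl[(x_1,\dots,\widehat{x_j},\dots,x_n)-(x_1,\dots,x_{j-1},x_j\rhd x_{j+1},\dots,x_j\rhd x_n)\bigr]. \] A Beck module over $X$ is an abelian group object in the category of racks over $X$. Let $\Omega_X$ be the left adjoint of the forgetful functor from Beck modules over $X$ to racks over $X$. Let $A\times X\to X$ be the trivial Beck module given by $A$: the product of $X$ with the rack $A$ whose operation is $a\rhd b=b$, with the addition of $A$ on the fibres. A simplicial rack is free if it has a basis in each degree such that the degeneracies map basis elements to basis elements. A cofibrant replacement of $X$ is a retract $F_\bullet$ of a free simplicial rack, together with a morphism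 of simplicial racks from $F_\bullet$ to the constant simplicial rack $X$ that is a weak equivalence of the underlying simplicial sets. The Quillen cohomology (for the theory of racks) is \[ \mathrm{D}^n_X(X;A)=\mathrm{H}^n\bigl(\mathrm{Hom}(\Omega_X(F_\bullet),\,A\times X)\bigr), \] where $\mathrm{Hom}$ is the group of morphisms of Beck modules over $X$ and the differentials are the alternating sums of the maps induced by the faces of $F_\bullet$. **Theorem.** The rack $X$ has a cofibrant replacement, and for every cofibrant replacement $F_\bullet\to X$ and every integer $n\geq 0$ there is an isomorphism of abelian groups \[ \mathrm{HR}^{n+1}(X;A)\cong\mathrm{D}^n_X(X;A). \] -/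

import Mathlib

universe u

/-- The category of racks. -/
structure RackCat : Type (u + 1) where
  of ::
  carrier : Type u
  [str : Rack carrier]

namespace RackCat

open CategoryTheory Limits MonoidalCategory CartesianMonoidalCategory Opposite
open scoped Quandles MonObj

attribute [instance] RackCat.str

instance : CoeSort RackCat.{u} (Type u) := ⟨RackCat.carrier⟩

instance : Category RackCat.{u} where
  Hom X Y := X.carrier →◃ Y.carrier
  id X := ShelfHom.id X.carrier
  comp f g := g.comp f

instance : ConcreteCategory RackCat.{u} (fun X Y => X.carrier →◃ Y.carrier) where
  hom f := f
  ofHom f := f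

@[ext] lemma hom_ext {X Y : RackCat.{u}} {f g : X ⟶ Y} (h : ∀ x : X, f x = g x) : f = g :=
  DFunLike.ext (F := X.carrier →◃ Y.carrier) f g h

@[simp] lemma map_act {X Y : RackCat.{u}} (f : X ⟶ Y) (a b : X) : f (a ◃ b) = f a ◃ f b :=
  ShelfHom.map_act f

@[simp] lemma map_invAct {X Y : RackCat.{u}} (f : X ⟶ Y) (a b : X) :
    f (a ◃⁻¹ b) = f a ◃⁻¹ f b := by
  rw [← Rack.left_cancel (f a), Rack.act_invAct_eq, ← map_act, Rack.act_invAct_eq]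

/-- The fibre product of racks: the subrack of `Y × Z` of the pairs with the same image in `X`. -/
def fiberProduct {X Y Z : RackCat.{u}} (f : Y ⟶ X) (g : Z ⟶ X) : RackCat.{u} where
  carrier := {q : Y × Z // f q.1 = g q.2}
  str :=
    { act := fun a b => ⟨(a.1.1 ◃ b.1.1, a.1.2 ◃ b.1.2), by simp [a.2, b.2]⟩
      self_distrib := by
        intro a b c
        exact Subtype.ext (Prod.ext Shelf.self_distrib Shelf.self_distrib)
      invAct := fun a b => ⟨(a.1.1 ◃⁻¹ b.1.1, a.1.2 ◃⁻¹ b.1.2), by simp [a.2, b.2]⟩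
      left_inv := fun a b => Subtype.ext (Prod.ext (Rack.left_inv _ _) (Rack.left_inv _ _))
      right_inv := fun a b => Subtype.ext (Prod.ext (Rack.right_inv _ _) (Rack.right_inv _ _)) }

lemma over_w {X : RackCat.{u}} {Y Z : Over X} (f : Y ⟶ Z) (y : Y.left) :
    Z.hom (f.left y) = Y.hom y :=
  ConcreteCategory.congr_hom (Over.w f) y

/-- A rack homomorphism from a map that respects the operation. -/
def mkHom {Y Z : RackCat.{u}} (f : Y → Z) (h : ∀ a b : Y, f (a ◃ b) = f a ◃ f b) : Y ⟶ Z :=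
  ShelfHom.mk f (h _ _)

@[simp] lemma mkHom_apply {Y Z : RackCat.{u}} (f : Y → Z)
    (h : ∀ a b : Y, f (a ◃ b) = f a ◃ f b) (y : Y) : mkHom f h y = f y := rfl

/-- A morphism in the slice category from a map of the total spaces. -/
def mkOverHom {X : RackCat.{u}} {Y Z : Over X} (f : Y.left → Z.left)
    (h : ∀ a b : Y.left, f (a ◃ b) = f a ◃ f b) (w : ∀ y, Z.hom (f y) = Y.hom y) : Y ⟶ Z :=
  Over.homMk (mkHom f h) (hom_ext w)

@[simp] lemma mkOverHom_left_apply {X : RackCat.{u}} {Y Z : Over X} (f : Y.left → Z.left)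
    (h : ∀ a b : Y.left, f (a ◃ b) = f a ◃ f b) (w : ∀ y, Z.hom (f y) = Y.hom y) (y : Y.left) :
    (mkOverHom f h w).left y = f y := rfl

/-- The product of two objects of the slice category over `X`. -/
def overProd {X : RackCat.{u}} (Y Z : Over X) : Over X :=
  Over.mk (Y := fiberProduct Y.hom Z.hom)
    (mkHom (fun q => Y.hom q.1.1) fun _ _ => map_act Y.hom _ _)

/-- The first projection of the product in the slice category. -/
def overFst {X : RackCat.{u}} (Y Z : Over X) : overProd Y Z ⟶ Y :=
  mkOverHom (fun q => q.1.1) (fun _ _ => rfl) fun _ => rfl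

/-- The second projection of the product in the slice category. -/
def overSnd {X : RackCat.{u}} (Y Z : Over X) : overProd Y Z ⟶ Z :=
  mkOverHom (fun q => q.1.2) (fun _ _ => rfl) fun q => q.2.symm

/-- The universal property of the product in the slice category. -/
def overLift {X : RackCat.{u}} {T Y Z : Over X} (f : T ⟶ Y) (g : T ⟶ Z) : T ⟶ overProd Y Z :=
  mkOverHom (fun t => ⟨(f.left t, g.left t), by rw [over_w, over_w]⟩)
    (fun _ _ => Subtype.ext (Prod.ext (map_act f.left _ _) (map_act g.left _ _)))
    fun t => over_w f t

lemma over_ext {X : RackCat.{u}} {Y Z : Over X} {f g : Y ⟶ Z}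
    (h : ∀ y : Y.left, f.left y = g.left y) : f = g :=
  Over.OverMorphism.ext (hom_ext h)

lemma over_congr {X : RackCat.{u}} {Y Z : Over X} {f g : Y ⟶ Z} (h : f = g) (y : Y.left) :
    f.left y = g.left y := by
  rw [h]

/-- The slice category of racks over `X` with its finite products. -/
instance (X : RackCat.{u}) : CartesianMonoidalCategory (Over X) :=
  .ofChosenFiniteProducts
    ⟨asEmptyCone (Over.mk (𝟙 X)), IsTerminal.ofUniqueHom (fun Y => Over.homMk Y.hom)
      fun Y m => over_ext fun y => over_w m y⟩
    fun Y Z => ⟨BinaryFan.mk (overFst Y Z) (overSnd Y Z),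
      BinaryFan.IsLimit.mk _ (fun f g => overLift f g) (fun _ _ => rfl) (fun _ _ => rfl)
        (fun f g m h₁ h₂ => over_ext fun t => Subtype.ext (Prod.ext
          (by subst h₁; rfl) (by subst h₂; rfl)))⟩

instance (X : RackCat.{u}) : BraidedCategory (Over X) := .ofCartesianMonoidalCategory

variable {X : RackCat.{u}}

/-- A pair of points in the same fibre, as a point of the product in the slice category. -/
def pair {Y Z : Over X} (a : Y.left) (b : Z.left) (h : Y.hom a = Z.hom b) : (Y ⊗ Z).left :=
  (⟨(a, b), h⟩ : {q : Y.left × Z.left // Y.hom q.1 = Z.hom q.2})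

lemma pair_congr {Y Z : Over X} {a a' : Y.left} {b b' : Z.left} (ha : a = a') (hb : b = b')
    (h : Y.hom a = Z.hom b) : pair a b h = pair a' b' (by rw [← ha, ← hb, h]) := by
  subst ha hb; rfl

/-- Beck modules over a rack `X`: the abelian group objects in the slice category over `X`. -/
abbrev BeckModule (X : RackCat.{u}) := CommGrp (Over X)

/-- A Beck module from a rack over `X` and operations that satisfy the axioms of an
abelian group on each fibre. -/
def mkBeckModule (E : Over X) (z : 𝟙_ (Over X) ⟶ E) (m : E ⊗ E ⟶ E) (n : E ⟶ E)
    (zero_add : ∀ a : E.left, m.left (pair (z.left (E.hom a : X)) a (over_w z _)) = a)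
    (neg_add : ∀ a : E.left, m.left (pair (n.left a) a (over_w n _)) = z.left (E.hom a : X))
    (comm : ∀ (a b : E.left) (h : E.hom a = E.hom b),
      m.left (pair b a h.symm) = m.left (pair a b h))
    (assoc : ∀ (a b c : E.left) (h : E.hom a = E.hom b) (h' : E.hom b = E.hom c),
      m.left (pair (m.left (pair a b h)) c ((over_w m _).trans (h.trans h'))) =
        m.left (pair a (m.left (pair b c h')) (h.trans (over_w m (pair b c h')).symm))) :
    BeckModule X :=
  letI : GrpObj E :=
    { one := z
      mul := m
      inv := n
      one_mul := over_ext fun t => by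
        obtain ⟨⟨x, a⟩, h⟩ := t
        obtain rfl : x = (E.hom a : X) := h
        exact zero_add a
      mul_one := over_ext fun t => by
        obtain ⟨⟨a, x⟩, h⟩ := t
        obtain rfl : (E.hom a : X) = x := h
        exact (comm _ _ _).trans (zero_add a)
      mul_assoc := over_ext fun t => by
        obtain ⟨⟨⟨⟨a, b⟩, h⟩, c⟩, h'⟩ := t
        exact assoc a b c h (h.symm.trans h')
      left_inv := over_ext fun a => neg_add a
      right_inv := over_ext fun a => (comm _ _ _).trans (neg_add a) }
  haveI : IsCommMonObj E :=
    { mul_comm := over_ext fun t => by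
        obtain ⟨⟨a, b⟩, h⟩ := t
        exact comm a b h }
  ⟨E⟩

namespace BeckModule

variable (M : BeckModule X)

/-- The sum of two points in the same fibre of a Beck module. -/
def add (a b : M.X.left) (h : M.X.hom a = M.X.hom b) : M.X.left := μ[M.X].left (pair a b h)

/-- The zero of the fibre over `x`. -/
def zero (x : X) : M.X.left := η[M.X].left x

/-- The negative of a point of a Beck module. -/
def neg (a : M.X.left) : M.X.left := ι[M.X].left a

lemma hom_add (a b : M.X.left) (h) : M.X.hom (M.add a b h) = M.X.hom a := over_w μ[M.X] _
lemma hom_zero (x : X) : M.X.hom (M.zero x) = x := over_w η[M.X] _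
lemma hom_neg (a : M.X.left) : M.X.hom (M.neg a) = M.X.hom a := over_w ι[M.X] _

lemma zero_add (a : M.X.left) :
    M.add (M.zero (M.X.hom a : X)) a (M.hom_zero _) = a :=
  over_congr (MonObj.one_mul M.X) (pair (Y := 𝟙_ (Over X)) (M.X.hom a : X) a rfl)

lemma zero_add' (x : X) (a : M.X.left) (h : x = M.X.hom a) :
    M.add (M.zero x) a ((M.hom_zero x).trans h) = a := by
  subst h
  exact M.zero_add a

lemma neg_add (a : M.X.left) : M.add (M.neg a) a (M.hom_neg _) = M.zero (M.X.hom a : X) :=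
  over_congr (GrpObj.left_inv M.X) a

lemma add_comm (a b : M.X.left) (h : M.X.hom a = M.X.hom b) :
    M.add b a h.symm = M.add a b h :=
  over_congr (IsCommMonObj.mul_comm M.X) (pair a b h)

lemma add_assoc (a b c : M.X.left) (h : M.X.hom a = M.X.hom b) (h' : M.X.hom b = M.X.hom c) :
    M.add (M.add a b h) c ((M.hom_add _ _ _).trans (h.trans h')) =
      M.add a (M.add b c h') (h.trans (M.hom_add _ _ _).symm) :=
  over_congr (MonObj.mul_assoc M.X) (pair (Y := M.X ⊗ M.X) (pair a b h) c (h.trans h'))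

lemma add_act (a b c d : M.X.left) (h : M.X.hom a = M.X.hom b) (h' : M.X.hom c = M.X.hom d) :
    M.add (a ◃ c) (b ◃ d) (by simp [h, h']) = M.add a b h ◃ M.add c d h' :=
  map_act μ[M.X].left (pair a b h) (pair c d h')

lemma zero_act (x y : X) : M.zero (x ◃ y) = M.zero x ◃ M.zero y := map_act η[M.X].left x y

lemma neg_act (a b : M.X.left) : M.neg (a ◃ b) = M.neg a ◃ M.neg b := map_act ι[M.X].left a b

end BeckModule

/-- The product `A × X` of a rack `X` with the trivial rack on `A`, in which `a ◃ b = b`. -/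
def trivialRackProd (A : Type u) (X : RackCat.{u}) : RackCat.{u} where
  carrier := A × X
  str :=
    { act := fun p q => (q.1, p.2 ◃ q.2)
      self_distrib := Prod.ext rfl Shelf.self_distrib
      invAct := fun p q => (q.1, p.2 ◃⁻¹ q.2)
      left_inv := fun _ _ => Prod.ext rfl (Rack.left_inv _ _)
      right_inv := fun _ _ => Prod.ext rfl (Rack.right_inv _ _) }

/-- The trivial Beck module `A × X → X` of an abelian group `A`, with the addition of `A` on the
fibres. -/
def trivialBeckModule (A : Type u) [AddCommGroup A] (X : RackCat.{u}) : BeckModule X :=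
  mkBeckModule (Over.mk (Y := trivialRackProd A X) (mkHom Prod.snd fun _ _ => rfl))
    (mkOverHom (fun x => ((0 : A), x)) (fun _ _ => rfl) fun _ => rfl)
    (mkOverHom (fun t => (t.1.1.1 + t.1.2.1, t.1.1.2))
      (fun _ _ => rfl) fun _ => rfl)
    (mkOverHom (fun a => (-a.1, a.2)) (fun _ _ => rfl) fun _ => rfl)
    (fun a => Prod.ext (_root_.zero_add a.1) rfl)
    (fun a => Prod.ext (neg_add_cancel a.1) rfl)
    (fun a b h => Prod.ext (_root_.add_comm b.1 a.1) h.symm)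
    (fun a b c _ _ => Prod.ext (_root_.add_assoc a.1 b.1 c.1) rfl)


/-! ### The abelianization functor -/

/-- Formal expressions in the operations of a Beck module over `X`, with generators the points of a
rack `Y` over `X`. -/
inductive BeckTerm (Y : Over X) : Type u where
  | gen (y : Y.left) : BeckTerm Y
  | zero (x : X) : BeckTerm Y
  | add (a b : BeckTerm Y) : BeckTerm Y
  | neg (a : BeckTerm Y) : BeckTerm Y
  | act (a b : BeckTerm Y) : BeckTerm Y
  | invAct (a b : BeckTerm Y) : BeckTerm Y

namespace BeckTerm

variable {Y : Over X}

/-- The point of `X` over which an expression lies. A formal sum of expressions that do not lie over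
the same point is read as its first summand. -/
def base : BeckTerm Y → X
  | gen y => Y.hom y
  | zero x => x
  | add a _ => base a
  | neg a => base a
  | act a b => base a ◃ base b
  | invAct a b => base a ◃⁻¹ base b

open Classical in
/-- The value of an expression in a Beck module `M`, for a morphism `Y ⟶ M` over `X`. -/
noncomputable def value (M : BeckModule X) (f : Y ⟶ M.X) : BeckTerm Y → M.X.left
  | gen y => f.left y
  | zero x => M.zero x
  | add a b =>
      if h : M.X.hom (value M f a) = M.X.hom (value M f b) then M.add _ _ h else value M f a
  | neg a => M.neg (value M f a)
  | act a b => value M f a ◃ value M f b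
  | invAct a b => value M f a ◃⁻¹ value M f b

lemma hom_value (M : BeckModule X) (f : Y ⟶ M.X) (a : BeckTerm Y) :
    M.X.hom (value M f a) = base a := by
  induction a with
  | gen y => exact over_w f y
  | zero x => exact M.hom_zero x
  | add a b iha ihb =>
    simp only [value]
    split_ifs with h
    · exact (M.hom_add _ _ h).trans iha
    · exact iha
  | neg a ih => exact (M.hom_neg _).trans ih
  | act a b iha ihb => simp only [value, base, ← iha, ← ihb]; exact map_act M.X.hom _ _
  | invAct a b iha ihb => simp only [value, base, ← iha, ← ihb]; exact map_invAct M.X.hom _ _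

lemma value_add (M : BeckModule X) (f : Y ⟶ M.X) (a b : BeckTerm Y) (h : base a = base b) :
    value M f (add a b) =
      M.add (value M f a) (value M f b) ((hom_value M f a).trans (h.trans (hom_value M f b).symm)) :=
  dif_pos _

lemma value_add_of_ne (M : BeckModule X) (f : Y ⟶ M.X) (a b : BeckTerm Y) (h : base a ≠ base b) :
    value M f (add a b) = value M f a :=
  dif_neg fun h' => h ((hom_value M f a).symm.trans (h'.trans (hom_value M f b)))

lemma value_add_congr (M : BeckModule X) (f : Y ⟶ M.X) {a a' b b' : BeckTerm Y}
    (ha : value M f a = value M f a') (hb : value M f b = value M f b') :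
    value M f (add a b) = value M f (add a' b') := by
  simp only [value]
  generalize value M f a = x at ha
  generalize value M f b = y at hb
  subst ha hb
  rfl

/-- Two expressions are identified if they lie over the same point and if they have the same value
in all Beck modules. -/
instance setoid (Y : Over X) : Setoid (BeckTerm Y) where
  r a b := base a = base b ∧ ∀ (M : BeckModule X) (f : Y ⟶ M.X), value M f a = value M f b
  iseqv :=
    { refl := fun _ => ⟨rfl, fun _ _ => rfl⟩
      symm := fun h => ⟨h.1.symm, fun M f => (h.2 M f).symm⟩
      trans := fun h h' => ⟨h.1.trans h'.1, fun M f => (h.2 M f).trans (h'.2 M f)⟩ }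

end BeckTerm

open BeckTerm in
/-- The rack of expressions modulo the identities that hold in all Beck modules. -/
def freeRack (Y : Over X) : RackCat.{u} where
  carrier := Quotient (BeckTerm.setoid Y)
  str :=
    { act := Quotient.map₂ BeckTerm.act fun a a' h b b' h' =>
        ⟨by simp only [base, h.1, h'.1], fun M f => by simp only [value, h.2 M f, h'.2 M f]⟩
      self_distrib := by
        rintro ⟨a⟩ ⟨b⟩ ⟨c⟩
        exact Quotient.sound ⟨Shelf.self_distrib, fun M f => Shelf.self_distrib⟩
      invAct := Quotient.map₂ BeckTerm.invAct fun a a' h b b' h' =>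
        ⟨by simp only [base, h.1, h'.1], fun M f => by simp only [value, h.2 M f, h'.2 M f]⟩
      left_inv := by
        rintro ⟨a⟩ ⟨b⟩
        exact Quotient.sound ⟨Rack.left_inv _ _, fun M f => Rack.left_inv _ _⟩
      right_inv := by
        rintro ⟨a⟩ ⟨b⟩
        exact Quotient.sound ⟨Rack.right_inv _ _, fun M f => Rack.right_inv _ _⟩ }

/-- The rack of expressions, as a rack over `X`. -/
def freeOver (Y : Over X) : Over X :=
  Over.mk (Y := freeRack Y) (mkHom (Quotient.lift BeckTerm.base fun _ _ h => h.1) (by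
    rintro ⟨a⟩ ⟨b⟩
    rfl))

open BeckTerm in
/-- The free Beck module on a rack `Y` over `X`. -/
def freeBeckModule (Y : Over X) : BeckModule X :=
  mkBeckModule (freeOver Y)
    (mkOverHom (fun x => (⟦BeckTerm.zero x⟧ : Quotient (BeckTerm.setoid Y)))
      (fun x y => Quotient.sound ⟨rfl, fun M _ => M.zero_act x y⟩) fun _ => rfl)
    (mkOverHom (fun t => Quotient.map₂ (sa := BeckTerm.setoid Y) (sb := BeckTerm.setoid Y)
        (sc := BeckTerm.setoid Y) BeckTerm.add (fun a a' h b b' h' =>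
          ⟨h.1, fun M f => value_add_congr M f (h.2 M f) (h'.2 M f)⟩) t.1.1 t.1.2)
      (by
        rintro ⟨⟨⟨a⟩, ⟨b⟩⟩, h⟩ ⟨⟨⟨c⟩, ⟨d⟩⟩, h'⟩
        replace h : base a = base b := h
        replace h' : base c = base d := h'
        refine Quotient.sound ⟨rfl, fun M f => ?_⟩
        rw [value_add _ _ _ _ (by simp only [base, h, h'])]
        change _ = value M f (add a b) ◃ value M f (add c d)
        rw [value_add _ _ _ _ h, value_add _ _ _ _ h']
        exact M.add_act _ _ _ _ _ _)
      (by
        rintro ⟨⟨⟨a⟩, ⟨b⟩⟩, h⟩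
        rfl))
    (mkOverHom (Quotient.map (sa := BeckTerm.setoid Y) (sb := BeckTerm.setoid Y) BeckTerm.neg
        fun a a' h => ⟨h.1, fun M f => by simp only [value, h.2 M f]⟩)
      (by
        rintro ⟨a⟩ ⟨b⟩
        exact Quotient.sound ⟨rfl, fun M _ => M.neg_act _ _⟩)
      (by
        rintro ⟨a⟩
        rfl))
    (by
      rintro ⟨a⟩
      refine Quotient.sound ⟨rfl, fun M f => ?_⟩
      change value M f (add (zero (base a)) a) = value M f a
      rw [value_add M f (zero (base a)) a rfl]
      exact M.zero_add' _ _ (hom_value M f a).symm)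
    (by
      rintro ⟨a⟩
      refine Quotient.sound ⟨rfl, fun M f => ?_⟩
      change value M f (add (neg a) a) = M.zero (base a)
      rw [value_add M f (neg a) a rfl]
      exact (M.neg_add (value M f a)).trans (congrArg M.zero (hom_value M f a)))
    (by
      rintro ⟨a⟩ ⟨b⟩ h
      replace h : base a = base b := h
      refine Quotient.sound ⟨h.symm, fun M f => ?_⟩
      rw [value_add _ _ _ _ h, value_add _ _ _ _ h.symm]
      exact M.add_comm _ _ _)
    (by
      rintro ⟨a⟩ ⟨b⟩ ⟨c⟩ h h'
      replace h : base a = base b := h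
      replace h' : base b = base c := h'
      refine Quotient.sound ⟨rfl, fun M f => ?_⟩
      rw [value_add _ _ (add a b) c (h.trans h'), value_add _ _ a (add b c) h]
      simp only [value_add _ _ _ _ h, value_add _ _ _ _ h']
      exact M.add_assoc _ _ _ _ _)

/-- The universal morphism to the free Beck module. -/
def freeUnit (Y : Over X) : Y ⟶ (freeBeckModule Y).X :=
  mkOverHom (Z := freeOver Y) (fun y => (⟦BeckTerm.gen y⟧ : Quotient (BeckTerm.setoid Y)))
    (fun a b => Quotient.sound ⟨map_act Y.hom a b, fun _ f => map_act f.left a b⟩) fun _ => rfl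

open BeckTerm in
/-- The extension of a morphism `Y ⟶ M` over `X` to the free Beck module. -/
noncomputable def freeLift {Y : Over X} {M : BeckModule X} (f : Y ⟶ M.X) : freeBeckModule Y ⟶ M :=
  InducedCategory.homMk (Grp.homMk'' (A := (freeBeckModule Y).toGrp) (B := M.toGrp)
    (mkOverHom (Y := freeOver Y) (Quotient.lift (value M f) fun _ _ h => h.2 M f)
      (by
        rintro ⟨a⟩ ⟨b⟩
        rfl)
      (by
        rintro ⟨a⟩
        exact hom_value M f a))
    (over_ext fun _ => rfl)
    (over_ext (by
      rintro ⟨⟨⟨a⟩, ⟨b⟩⟩, h⟩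
      exact value_add M f a b h)))

lemma freeLift_unit {Y : Over X} {M : BeckModule X} (f : Y ⟶ M.X) :
    freeUnit Y ≫ (freeLift f).hom.hom.hom = f := rfl

open BeckTerm in
lemma freeLift_unique {Y : Over X} {M : BeckModule X} (g : freeBeckModule Y ⟶ M) :
    freeLift (freeUnit Y ≫ g.hom.hom.hom) = g := by
  refine CommGrp.hom_ext _ _ (over_ext ?_)
  rintro ⟨a⟩
  change value M _ a = g.hom.hom.hom.left (⟦a⟧ : Quotient (BeckTerm.setoid Y))
  induction a with
  | gen y => rfl
  | zero x => exact (over_congr (IsMonHom.one_hom g.hom.hom.hom) x).symm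
  | add a b iha ihb =>
    by_cases h : base a = base b
    · rw [value_add _ _ _ _ h]
      have := over_congr (IsMonHom.mul_hom g.hom.hom.hom)
        (pair (⟦a⟧ : Quotient (BeckTerm.setoid Y)) (⟦b⟧ : Quotient (BeckTerm.setoid Y)) h)
      refine Eq.trans ?_ this.symm
      exact congrArg μ[M.X].left (pair_congr iha ihb _)
    · rw [value_add_of_ne _ _ _ _ h, iha]
      congr 1
      exact Quotient.sound ⟨rfl, fun M f => (value_add_of_ne _ _ _ _ h).symm⟩
  | neg a ih =>
    have := over_congr (GrpObj.inv_hom g.hom.hom.hom) (⟦a⟧ : Quotient (BeckTerm.setoid Y))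
    exact (congrArg M.neg ih).trans this.symm
  | act a b iha ihb =>
    exact (congrArg₂ Shelf.act iha ihb).trans (map_act g.hom.hom.hom.left _ _).symm
  | invAct a b iha ihb =>
    exact (congrArg₂ Rack.invAct iha ihb).trans (map_invAct g.hom.hom.hom.left _ _).symm

/-- The bijection between the morphisms of Beck modules out of the free one and the morphisms over
`X` out of its generators. -/
noncomputable def freeEquiv (Y : Over X) (M : BeckModule X) :
    (freeBeckModule Y ⟶ M) ≃ (Y ⟶ (CommGrp.forget (Over X)).obj M) where
  toFun g := freeUnit Y ≫ g.hom.hom.hom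
  invFun f := freeLift f
  left_inv g := freeLift_unique g
  right_inv f := freeLift_unit f

/-- The abelianization functor `Ω_X` from racks over `X` to Beck modules over `X`. -/
noncomputable def abelianization (X : RackCat.{u}) : Over X ⥤ BeckModule X :=
  Adjunction.leftAdjointOfEquiv (G := CommGrp.forget (Over X)) freeEquiv fun _ _ _ _ _ => rfl

/-- The functor `Ω_X` is left adjoint to the forgetful functor. -/
noncomputable def abelianizationAdjunction (X : RackCat.{u}) :
    abelianization X ⊣ CommGrp.forget (Over X) :=
  Adjunction.adjunctionOfEquivLeft (G := CommGrp.forget (Over X)) freeEquiv fun _ _ _ _ _ => rfl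


/-! ### Rack cohomology -/

/-- The face `(x₁, …, xₙ) ↦ (x₁, …, x̂ⱼ, …, xₙ)`. -/
def face₀ (X : RackCat.{u}) {n : ℕ} (j : Fin (n + 1)) (x : Fin (n + 1) → X) : Fin n → X :=
  fun k => x (j.succAbove k)

/-- The face `(x₁, …, xₙ) ↦ (x₁, …, xⱼ₋₁, xⱼ ◃ xⱼ₊₁, …, xⱼ ◃ xₙ)`. -/
def face₁ (X : RackCat.{u}) {n : ℕ} (j : Fin (n + 1)) (x : Fin (n + 1) → X) : Fin n → X :=
  fun k => if k.castSucc < j then x k.castSucc else x j ◃ x k.succ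

/-- The free abelian group on the `n`-tuples of points of `X`. -/
abbrev rackChains (X : RackCat.{u}) (n : ℕ) : AddCommGrpCat.{u} :=
  AddCommGrpCat.of (FreeAbelianGroup (Fin n → X))

/-- The homomorphism `δⱼ⁰ - δⱼ¹`. -/
def faceDiff (X : RackCat.{u}) {n : ℕ} (j : Fin (n + 1)) :
    rackChains X (n + 1) ⟶ rackChains X n :=
  AddCommGrpCat.ofHom (FreeAbelianGroup.map (face₀ X j) - FreeAbelianGroup.map (face₁ X j))

/-- The differential `∑ⱼ (-1)ʲ (δⱼ⁰ - δⱼ¹)`; the index `j` runs from `1` to `n + 1`, and the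
corresponding element of `Fin (n + 1)` is `j - 1`. -/
def rackDifferential (X : RackCat.{u}) (n : ℕ) : rackChains X (n + 1) ⟶ rackChains X n :=
  ∑ j : Fin (n + 1), (-1 : ℤ) ^ ((j : ℕ) + 1) • faceDiff X j

lemma face_comm (X : RackCat.{u}) {n : ℕ} {i j : Fin (n + 1)} (h : i ≤ j) (x : Fin (n + 2) → X) :
    face₀ X i (face₀ X j.succ x) = face₀ X j (face₀ X i.castSucc x) ∧
    face₀ X i (face₁ X j.succ x) = face₁ X j (face₀ X i.castSucc x) ∧
    face₁ X i (face₀ X j.succ x) = face₀ X j (face₁ X i.castSucc x) ∧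
    face₁ X i (face₁ X j.succ x) = face₁ X j (face₁ X i.castSucc x) := by
  rw [Fin.le_def] at h
  refine ⟨?_, ?_, ?_, ?_⟩ <;> funext k <;>
    simp only [face₀, face₁, Fin.succAbove, Fin.lt_def, Fin.val_castSucc, Fin.val_succ,
      apply_ite Fin.val] <;>
    split_ifs <;> first
      | omega
      | rfl
      | exact Shelf.self_distrib

lemma faceDiff_comp (X : RackCat.{u}) {n : ℕ} {i j : Fin (n + 1)} (h : i ≤ j) :
    faceDiff X j.succ ≫ faceDiff X i = faceDiff X i.castSucc ≫ faceDiff X j := by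
  refine AddCommGrpCat.hom_ext (FreeAbelianGroup.lift_ext _ _ fun x => ?_)
  obtain ⟨h₁, h₂, h₃, h₄⟩ := face_comm X h x
  simp only [faceDiff, AddCommGrpCat.hom_comp, AddCommGrpCat.hom_ofHom, AddMonoidHom.comp_apply,
    AddMonoidHom.sub_apply, FreeAbelianGroup.map_of_apply, map_sub, h₁, h₂, h₃, h₄]
  abel

lemma rackDifferential_comp (X : RackCat.{u}) (n : ℕ) :
    rackDifferential X (n + 1) ≫ rackDifferential X n = 0 := by
  simp only [rackDifferential, Preadditive.comp_sum, Preadditive.sum_comp, ← Finset.sum_product']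
  let P := Fin (n + 1) × Fin (n + 2)
  let S : Finset P := {ij : P | (ij.2 : ℕ) ≤ (ij.1 : ℕ)}
  rw [Finset.univ_product_univ, ← Finset.sum_add_sum_compl S, ← eq_neg_iff_add_eq_zero,
    ← Finset.sum_neg_distrib]
  let φ : ∀ ij : P, ij ∈ S → P := fun ij hij =>
    (Fin.castLT ij.2 (lt_of_le_of_lt (Finset.mem_filter.mp hij).right (Fin.is_lt ij.1)), ij.1.succ)
  apply Finset.sum_bij φ
  · intro ij hij
    simp_rw [S, φ, Finset.compl_filter, Finset.mem_filter_univ, Fin.val_succ,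
      Fin.val_castLT] at hij ⊢
    omega
  · rintro ⟨i, j⟩ hij ⟨i', j'⟩ hij' h
    obtain ⟨h₁, h₂⟩ := Prod.mk_inj.mp h
    simp only [Fin.ext_iff, Fin.val_succ, Fin.val_castLT] at h₁ h₂
    exact Prod.ext (Fin.ext (by simpa using h₂)) (Fin.ext h₁)
  · rintro ⟨i', j'⟩ hij'
    simp_rw [S, Finset.compl_filter, Finset.mem_filter_univ, not_le] at hij'
    refine ⟨(j'.pred <| ?_, Fin.castSucc i'), ?_, ?_⟩
    · rintro rfl
      simp only [Fin.val_zero, not_lt_zero] at hij'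
    · simp only [S, Finset.mem_filter_univ, Fin.val_castSucc, Fin.val_pred]
      omega
    · simp only [φ, Fin.castLT_castSucc, Fin.succ_pred]
  · rintro ⟨i, j⟩ hij
    replace hij : (j : ℕ) ≤ i := (Finset.mem_filter.mp hij).2
    have key := faceDiff_comp X (i := Fin.castLT j (lt_of_le_of_lt hij i.2)) (j := i) hij
    simp only [φ, Preadditive.zsmul_comp, Preadditive.comp_zsmul, smul_smul, ← neg_smul]
    rw [key, Fin.castSucc_castLT]
    congr 1
    simp only [Fin.val_succ, Fin.val_castLT, pow_succ]
    ring

/-- The rack complex `CR_•(X)`. -/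
noncomputable def rackComplex (X : RackCat.{u}) : ChainComplex AddCommGrpCat.{u} ℕ :=
  ChainComplex.of (rackChains X) (rackDifferential X) (rackDifferential_comp X)

/-- The cochain complex `Hom(C, A)` of homomorphisms of abelian groups. -/
noncomputable def homComplex (C : ChainComplex AddCommGrpCat.{u} ℕ) (A : AddCommGrpCat.{u}) :
    CochainComplex AddCommGrpCat.{u} ℕ :=
  CochainComplex.of (fun n => AddCommGrpCat.of (C.X n ⟶ A))
    (fun n => AddCommGrpCat.ofHom (Preadditive.leftComp A (C.d (n + 1) n))) fun n => by
      ext f x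
      have h : C.d (n + 2) (n + 1) ≫ C.d (n + 1) n ≫ f = 0 := by simp
      exact ConcreteCategory.congr_hom h x

/-- The rack cohomology `HR^n(X; A)`. -/
noncomputable def rackCohomology (X : RackCat.{u}) (A : Type u) [AddCommGroup A] (n : ℕ) :
    AddCommGrpCat.{u} :=
  (homComplex (rackComplex X) (AddCommGrpCat.of A)).homology n

/-! ### Cofibrant replacements -/

/-- The equivalence relation on maps of simplicial sets that is generated by simplicial homotopy. -/
def Homotopic {K L : SSet.{u}} (a b : K ⟶ L) : Prop :=
  Relation.EqvGen (fun a b : K ⟶ L => Nonempty (SSet.Homotopy a b)) a b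

/-- A map `f : K ⟶ L` of simplicial sets is a weak equivalence if, for every Kan complex `Z`,
precomposition with `f` is a bijection from the homotopy classes of maps `L ⟶ Z` to the homotopy
classes of maps `K ⟶ Z`. -/
def IsWeakEquivalence {K L : SSet.{u}} (f : K ⟶ L) : Prop :=
  ∀ (Z : SSet.{u}) [Z.KanComplex],
    (∀ g : K ⟶ Z, ∃ h : L ⟶ Z, Homotopic (f ≫ h) g) ∧
    ∀ h h' : L ⟶ Z, Homotopic (f ≫ h) (f ≫ h') → Homotopic h h'

/-- The underlying simplicial set of a simplicial rack. -/
def underlyingSSet : SimplicialObject RackCat.{u} ⥤ SSet.{u} :=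
  (SimplicialObject.whiskering _ _).obj (forget RackCat.{u})

/-- A rack is free on a subset `B` if every map from `B` to a rack extends uniquely to a
homomorphism. -/
def IsFreeOn (Y : RackCat.{u}) (B : Set Y) : Prop :=
  ∀ (Z : RackCat.{u}) (g : B → Z), ∃! φ : Y ⟶ Z, ∀ b : B, φ b = g b

open Simplicial in
/-- A simplicial rack is free if there are bases in all degrees that are preserved by the
degeneracies. -/
def IsFreeSimplicial (G : SimplicialObject RackCat.{u}) : Prop :=
  ∃ B : ∀ n : ℕ, Set (G _⦋n⦌), (∀ n, IsFreeOn (G _⦋n⦌) (B n)) ∧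
    ∀ (n : ℕ) (i : Fin (n + 1)), ∀ b ∈ B n, G.σ i b ∈ B (n + 1)

/-- The cofibrant simplicial racks are the retracts of the free ones. -/
def IsCofibrant (F : SimplicialObject RackCat.{u}) : Prop :=
  ∃ G : SimplicialObject RackCat.{u}, IsFreeSimplicial G ∧ Nonempty (Retract F G)

/-- A cofibrant replacement of `X`: a cofibrant simplicial rack `F` with a weak equivalence to the
constant simplicial rack `X`. -/
structure CofibrantReplacement (X : RackCat.{u}) where
  /-- The simplicial rack. -/
  F : SimplicialObject RackCat.{u}
  /-- The augmentation to the constant simplicial rack. -/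
  ε : F ⟶ (SimplicialObject.const RackCat.{u}).obj X
  cofibrant : IsCofibrant F
  weakEquivalence : IsWeakEquivalence (underlyingSSet.map ε)

/-! ### Quillen cohomology -/

namespace CofibrantReplacement

variable (R : CofibrantReplacement X)

/-- The cofibrant replacement as a simplicial object of the slice category over `X`. -/
def slice : SimplicialObject (Over X) where
  obj n := Over.mk (R.ε.app n)
  map φ := Over.homMk (R.F.map φ) (by simp)

/-- The cotangent complex of `X`: the simplicial Beck module `Ω_X(F_•)`. -/
noncomputable def cotangentComplex : SimplicialObject (BeckModule X) :=
  R.slice ⋙ abelianization X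

end CofibrantReplacement

/-- The functor that sends a Beck module `N` to the abelian group of morphisms from `N` to `M`. -/
noncomputable def homFunctor (M : BeckModule X) : (BeckModule X)ᵒᵖ ⥤ AddCommGrpCat.{u} :=
  (CommGrp.forget₂Grp (Over X)).op ⋙ yonedaCommGrpGrpObj M ⋙ CommGrpCat.toAddCommGrp

/-- The Quillen cohomology `D^n_X(X; M)`, computed from a cofibrant replacement of `X`: the cohomology
of the cochain complex `Hom(Ω_X(F_•), M)`, whose differentials are the alternating sums of the
maps induced by the faces. -/
noncomputable def quillenCohomology (R : CofibrantReplacement X) (M : BeckModule X) (n : ℕ) :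
    AddCommGrpCat.{u} :=
  ((AlgebraicTopology.alternatingCofaceMapComplex AddCommGrpCat.{u}).obj
    (R.cotangentComplex.rightOp ⋙ homFunctor M)).homology n

end RackCat

namespace RackCat

open CategoryTheory Limits MonoidalCategory CartesianMonoidalCategory Opposite
open Simplicial

/-! ### Simplicial abelian groups are Kan complexes -/

section Kan

variable (G : SimplicialObject AddCommGrpCat.{u})

/-! Consider the double complex C^{p,q} = Map(F_q^p, A) with p ≥ 1 and q ≥ 0. Its horizontal
differential is the rack coboundary of F_q. Its vertical differential is the simplicial coboundary
of the p-th power of F_•. The faces of F_• are rack homomorphisms, so the two commute.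

Rows. Each F_q is a retract of a free rack, and the rack cohomology of a free rack vanishes in
degrees ≥ 2 (`exists_rackCoboundary_of_free`). The kernel at p = 1 consists of the functions c with
c(a ◃ b) = c(b). These are the morphisms over X from F_q to A × X, hence the morphisms of Beck
modules from Ω_X(F_q) to A × X (`range_quillenCochain`). This edge is the complex of Quillen
cohomology.

Columns. The p-th power of F_• → X induces an isomorphism on cohomology, and a constant simplicial
set has cohomology only in degree 0. The columns are therefore exact in positive degrees, and the
kernel at q = 0 is Map(X^p, A) (`range_rackCochain`). This edge is the complex of rack cohomology in
degrees ≥ 1.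

A zigzag along the antidiagonal compares the two edges (`nonempty_edgeEquiv`). The index shift
arises because p starts at 1 and q at 0.

Weak equivalences are defined by maps to Kan complexes, so cohomology has to be represented. The
cocycles of degree n on Δ[m] ⊗ L form a simplicial abelian group in m, which is Kan. Maps from K to
it correspond to cocycles on K ⊗ L, and homotopic maps to cohomologous cocycles. The parameter L
allows the factors of a power to be replaced one by one, without a Künneth theorem.

A cofibrant replacement exists by the bar construction for the comonad of free racks, which the
inclusion of generators contracts as a simplicial set. -/

lemma δ_δ_apply {n : ℕ} {i j : Fin (n + 2)} (h : i ≤ j) (w : G _⦋n + 2⦌) :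
    G.δ i (G.δ j.succ w) = G.δ j (G.δ i.castSucc w) :=
  ConcreteCategory.congr_hom (G.δ_comp_δ h) w

/-- Moore's filling algorithm for the horns in a simplicial abelian group. -/
lemma exists_filler {n : ℕ} (k : Fin (n + 3)) (x : Fin (n + 3) → G _⦋n + 1⦌)
    (hx : ∀ i j : Fin (n + 2), i ≤ j → i.castSucc ≠ k → j.succ ≠ k →
      G.δ i (x j.succ) = G.δ j (x i.castSucc)) :
    ∃ w : G _⦋n + 2⦌, ∀ j, j ≠ k → G.δ j w = x j := by
  -- Faces below k are corrected in ascending order. Adding σ_t of the error at face t repairs that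
  -- face. It leaves the faces i < t alone, because compatibility of the horn makes the i-th face of
  -- the error vanish.
  have asc : ∀ m : ℕ, m ≤ k → ∃ w : G _⦋n + 2⦌, ∀ j : Fin (n + 3), (j : ℕ) < m →
      G.δ j w = x j := by
    intro m
    induction m with
    | zero => exact fun _ => ⟨0, fun j hj => absurd hj (Nat.not_lt_zero _)⟩
    | succ m ih =>
      intro hm
      obtain ⟨w, hw⟩ := ih (by omega)
      let t : Fin (n + 2) := ⟨m, by omega⟩
      refine ⟨w + G.σ t (x t.castSucc - G.δ t.castSucc w), fun j hj => ?_⟩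
      rw [map_add]
      obtain hj | hj := Nat.lt_succ_iff_lt_or_eq.mp hj
      · obtain ⟨i, rfl⟩ : ∃ i : Fin (n + 2), j = i.castSucc := ⟨⟨j, by omega⟩, rfl⟩
        obtain ⟨r, hr⟩ : ∃ r : Fin (n + 1), t = r.succ :=
          Fin.exists_succ_eq.mpr (fun h => by simp [t, Fin.ext_iff] at h; simp [h] at hj) |>.imp
            fun _ h => h.symm
        have hir : (i : ℕ) ≤ r := by
          have : (t : ℕ) = r + 1 := by rw [hr]; rfl
          simp only [t, Fin.val_castSucc] at this hj
          omega
        have h1 : G.δ i.castSucc (G.σ t (x t.castSucc - G.δ t.castSucc w)) =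
            G.σ r (G.δ i (x t.castSucc - G.δ t.castSucc w)) := by
          rw [hr]
          exact ConcreteCategory.congr_hom (G.δ_comp_σ_of_le (i := i) (j := r)
            (by simpa [Fin.le_def] using hir)) _
        have h2 : t.castSucc = r.castSucc.succ := by rw [hr]; rfl
        have hi : i ≤ r.castSucc := by simpa [Fin.le_def] using hir
        rw [h1, map_sub, hw _ hj, h2, hx i r.castSucc hi (by
          intro h; rw [← h] at hm; simp at hj hm; omega) (by
          intro h; rw [← h, ← h2] at hm; simp [t] at hm), δ_δ_apply G hi, hw _ hj, sub_self,
          map_zero, add_zero]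
      · obtain rfl : j = t.castSucc := Fin.ext hj
        have : G.δ t.castSucc (G.σ t (x t.castSucc - G.δ t.castSucc w)) = _ :=
          ConcreteCategory.congr_hom (G.δ_comp_σ_self (i := t)) _
        rw [this]
        simp
  -- Faces above k are corrected from the top down. Here m counts the faces already repaired there,
  -- so for m = 0 the second alternative is void.
  have desc : ∀ m : ℕ, m ≤ n + 2 - k → ∃ w : G _⦋n + 2⦌, ∀ j : Fin (n + 3),
      ((j : ℕ) < k ∨ n + 3 ≤ j + m) → G.δ j w = x j := by
    intro m
    induction m with
    | zero =>
      intro _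
      obtain ⟨w, hw⟩ := asc k le_rfl
      exact ⟨w, fun j hj => hw j (by omega)⟩
    | succ m ih =>
      intro hm
      obtain ⟨w, hw⟩ := ih (by omega)
      -- The next face to repair is n + 2 - m = t + 1, and δ_{t+1} σ_t = id.
      let t : Fin (n + 2) := ⟨n + 1 - m, by omega⟩
      have ht : (t : ℕ) = n + 1 - m := rfl
      refine ⟨w + G.σ t (x t.succ - G.δ t.succ w), fun j hj => ?_⟩
      rw [map_add]
      by_cases hjt : j = t.succ
      · subst hjt
        have : G.δ t.succ (G.σ t (x t.succ - G.δ t.succ w)) = _ :=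
          ConcreteCategory.congr_hom (G.δ_comp_σ_succ (i := t)) _
        rw [this]
        simp
      have hjt' : (j : ℕ) ≠ t + 1 := fun h => hjt (Fin.ext h)
      have hjw := hw j (by omega)
      rw [hjw]
      suffices G.δ j (G.σ t (x t.succ - G.δ t.succ w)) = 0 by rw [this, add_zero]
      obtain hlt | hgt := lt_or_gt_of_ne hjt'
      · have hjk : (j : ℕ) < k := by omega
        obtain ⟨i, rfl⟩ : ∃ i : Fin (n + 2), j = i.castSucc := ⟨⟨j, by omega⟩, rfl⟩
        rw [Fin.val_castSucc] at hjk
        obtain ⟨r, hr⟩ : ∃ r : Fin (n + 1), t = r.succ :=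
          ⟨⟨t - 1, by omega⟩, Fin.ext (by simp; omega)⟩
        have hr' : (t : ℕ) = r + 1 := by rw [hr]; rfl
        have h1 : G.δ i.castSucc (G.σ t (x t.succ - G.δ t.succ w)) =
            G.σ r (G.δ i (x t.succ - G.δ t.succ w)) := by
          rw [hr]
          exact ConcreteCategory.congr_hom (G.δ_comp_σ_of_le (i := i) (j := r)
            (by simp [Fin.le_def]; omega)) _
        have hi : i ≤ t := by rw [Fin.le_def]; omega
        rw [h1, map_sub, hx i t hi (fun h => by rw [← h] at hjk; simp at hjk)
          (fun h => by rw [← h] at hm; simp at hm; omega), δ_δ_apply G hi, hjw, sub_self, map_zero]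
      · obtain ⟨i, rfl⟩ : ∃ i : Fin (n + 2), j = i.succ :=
          ⟨⟨j - 1, by omega⟩, Fin.ext (by simp; omega)⟩
        rw [Fin.val_succ] at hgt
        obtain ⟨r, hr⟩ : ∃ r : Fin (n + 1), t = r.castSucc := ⟨⟨t, by omega⟩, rfl⟩
        have hr' : (t : ℕ) = r := by rw [hr]; rfl
        have h1 : G.δ i.succ (G.σ t (x t.succ - G.δ t.succ w)) =
            G.σ r (G.δ i (x t.succ - G.δ t.succ w)) := by
          rw [hr]
          exact ConcreteCategory.congr_hom (G.δ_comp_σ_of_gt (i := i) (j := r)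
            (by simp [Fin.lt_def]; omega)) _
        -- The index t + 1 has to be presented as a `castSucc`, because it is now the smaller of the
        -- two faces being compared.
        obtain ⟨q, hq⟩ : ∃ q : Fin (n + 2), q.castSucc = t.succ :=
          ⟨⟨t + 1, by omega⟩, rfl⟩
        have hq' : (q : ℕ) = t + 1 := by simpa [Fin.ext_iff] using hq
        have hi : q ≤ i := by rw [Fin.le_def]; omega
        have e1 := hx q i hi (fun h => by rw [← h] at hm; simp at hm; omega)
          (fun h => by rw [← h] at hm; simp at hm; omega)
        have e2 := δ_δ_apply G hi w
        rw [hjw, hq] at e2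
        rw [hq] at e1
        rw [h1, map_sub, ← e1, ← e2, sub_self, map_zero]
  obtain ⟨w, hw⟩ := desc (n + 2 - k) le_rfl
  exact ⟨w, fun j hj => hw j (by
    have : (j : ℕ) ≠ k := fun h => hj (Fin.ext h)
    omega)⟩

/-- The underlying simplicial set of a simplicial abelian group. -/
abbrev underlyingOfAb : SSet.{u} := G ⋙ forget AddCommGrpCat.{u}

instance kanComplex_underlyingOfAb : (underlyingOfAb G).KanComplex := by
  rw [SSet.KanComplex.iff]
  intro n k f hf
  have key : ∃ w : G _⦋n + 1⦌, ∀ j (hj : j ≠ k), G.δ j w = SSet.yonedaEquiv (f j hj) := by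
    -- A horn in Δ[1] is a single vertex, which a degenerate edge fills. Compatibility of faces
    -- enters only from Δ[2] on.
    obtain _ | n := n
    · have hk : k = 0 ∨ k = 1 := by fin_cases k <;> simp
      obtain rfl | rfl := hk
      · refine ⟨G.σ 0 (SSet.yonedaEquiv (f 1 (by simp)) : G _⦋0⦌), fun j hj => ?_⟩
        obtain rfl : j = 1 := Fin.eq_one_of_ne_zero j hj
        exact ConcreteCategory.congr_hom (G.δ_comp_σ_succ (i := (0 : Fin 1))) _
      · refine ⟨G.σ 0 (SSet.yonedaEquiv (f 0 (by simp)) : G _⦋0⦌), fun j hj => ?_⟩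
        obtain rfl : j = 0 := by
          by_contra h
          exact hj (Fin.eq_one_of_ne_zero j h)
        exact ConcreteCategory.congr_hom (G.δ_comp_σ_self (i := (0 : Fin 1))) _
    · classical
      obtain ⟨w, hw⟩ := exists_filler G k
        -- The value 0 at the missing face is a dummy: both the compatibility condition and the
        -- conclusion exclude k.
        (fun j => if h : j ≠ k then (SSet.yonedaEquiv (f j h) : G _⦋n + 1⦌) else 0) (by
          intro i j hij hi hj
          rw [dif_pos hi, dif_pos hj]
          have := congrArg SSet.yonedaEquiv
            (hf i.castSucc j.succ hi hj (Fin.castSucc_lt_succ_iff.mpr hij))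
          rw [SSet.stdSimplex.yonedaEquiv_δ_comp, SSet.stdSimplex.yonedaEquiv_δ_comp] at this
          exact this.symm)
      exact ⟨w, fun j hj => (hw j hj).trans (dif_pos hj)⟩
  obtain ⟨w, hw⟩ := key
  refine ⟨SSet.yonedaEquiv.symm w, fun j hj => SSet.yonedaEquiv.injective ?_⟩
  rw [SSet.stdSimplex.yonedaEquiv_δ_comp, Equiv.apply_symm_apply]
  exact hw j hj

end Kan

end RackCat

namespace RackCat

open CategoryTheory Limits MonoidalCategory CartesianMonoidalCategory Opposite
open Simplicial

/-! ### Cohomology of simplicial sets -/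

section Cochains

variable {A : Type u} [AddCommGroup A]

/-- The pullback of cochains along a map of sets. -/
def pull {S T : Type u} (f : S → T) : (T → A) →+ (S → A) where
  toFun c := c ∘ f
  map_zero' := rfl
  map_add' _ _ := rfl

@[simp] lemma pull_apply {S T : Type u} (f : S → T) (c : T → A) (x : S) :
    pull f c x = c (f x) := rfl

/-- The differential of the cochains of a simplicial set. -/
def coboundary (A : Type u) [AddCommGroup A] (K : SSet.{u}) (n : ℕ) :
    (K _⦋n⦌ → A) →+ (K _⦋n + 1⦌ → A) :=
  ∑ i : Fin (n + 2), (-1 : ℤ) ^ (i : ℕ) • pull (K.δ i)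

lemma coboundary_apply (K : SSet.{u}) (n : ℕ) (c : K _⦋n⦌ → A) (x : K _⦋n + 1⦌) :
    coboundary A K n c x = ∑ i : Fin (n + 2), (-1 : ℤ) ^ (i : ℕ) • c (K.δ i x) := by
  simp [coboundary, AddMonoidHom.finsetSum_apply, Finset.sum_apply]

/-- The pullback of cochains along a map of simplicial sets. -/
def pullback {K L : SSet.{u}} (f : K ⟶ L) (n : ℕ) : (L _⦋n⦌ → A) →+ (K _⦋n⦌ → A) :=
  pull (f.app (op ⦋n⦌))

@[simp] lemma pullback_apply {K L : SSet.{u}} (f : K ⟶ L) (n : ℕ) (c : L _⦋n⦌ → A)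
    (x : K _⦋n⦌) : pullback f n c x = c (f.app (op ⦋n⦌) x) := rfl

lemma coboundary_pullback {K L : SSet.{u}} (f : K ⟶ L) (n : ℕ) (c : L _⦋n⦌ → A) :
    coboundary A K n (pullback f n c) = pullback f (n + 1) (coboundary A L n c) := by
  funext x
  simp only [coboundary_apply, pullback_apply]
  exact Finset.sum_congr rfl fun i _ => by rw [← SSet.δ_naturality_apply]

/-- The simplicial free abelian group on a simplicial set. -/
noncomputable abbrev freeSimplicial (K : SSet.{u}) : SimplicialObject AddCommGrpCat.{u} :=
  ((SimplicialObject.whiskering _ _).obj AddCommGrpCat.free).obj K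

/-- The generator of the simplicial free abelian group that belongs to a simplex. -/
noncomputable def gen {K : SSet.{u}} {n : ℕ} (x : K _⦋n⦌) : freeSimplicial K _⦋n⦌ :=
  FreeAbelianGroup.of x

/-- The extension of a cochain to the free abelian group. -/
noncomputable def extend {K : SSet.{u}} {n : ℕ} (c : K _⦋n⦌ → A) :
    freeSimplicial K _⦋n⦌ ⟶ AddCommGrpCat.of A :=
  AddCommGrpCat.ofHom (FreeAbelianGroup.lift c)

@[simp] lemma extend_gen {K : SSet.{u}} {n : ℕ} (c : K _⦋n⦌ → A) (x : K _⦋n⦌) :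
    extend c (gen x) = c x :=
  FreeAbelianGroup.lift_apply_of _ _

lemma free_hom_ext {K : SSet.{u}} {n : ℕ} {M : AddCommGrpCat.{u}}
    {f g : freeSimplicial K _⦋n⦌ ⟶ M} (h : ∀ x : K _⦋n⦌, f (gen x) = g (gen x)) : f = g :=
  AddCommGrpCat.hom_ext (FreeAbelianGroup.lift_ext _ _ h)

lemma free_δ_gen {K : SSet.{u}} {n : ℕ} (i : Fin (n + 2)) (x : K _⦋n + 1⦌) :
    (freeSimplicial K).δ i (gen x) = gen (K.δ i x) :=
  FreeAbelianGroup.map_of_apply _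

lemma hom_sum_apply {ι : Type*} {M N : AddCommGrpCat.{u}} (s : Finset ι) (f : ι → (M ⟶ N))
    (x : M) : (∑ i ∈ s, f i : M ⟶ N) x = ∑ i ∈ s, f i x :=
  map_sum (AddMonoidHom.mk' (fun g : M ⟶ N => g x) fun _ _ => rfl) f s

lemma hom_zsmul_apply {M N : AddCommGrpCat.{u}} (k : ℤ) (f : M ⟶ N) (x : M) :
    (k • f : M ⟶ N) x = k • f x := rfl

/-- Cochains are the homomorphisms out of the simplicial free abelian group. This dictionary imports
d² = 0 and chain homotopies from the alternating face map complex. -/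
lemma objD_comp_extend (K : SSet.{u}) (n : ℕ) (c : K _⦋n⦌ → A) :
    AlgebraicTopology.AlternatingFaceMapComplex.objD (freeSimplicial K) n ≫ extend c =
      extend (coboundary A K n c) := by
  refine free_hom_ext fun x => ?_
  rw [extend_gen, coboundary_apply, ConcreteCategory.comp_apply]
  simp only [AlgebraicTopology.AlternatingFaceMapComplex.objD, hom_sum_apply,
    hom_zsmul_apply, map_sum, map_zsmul, free_δ_gen]
  exact Finset.sum_congr rfl fun i _ => congrArg _ (extend_gen _ _)

lemma coboundary_coboundary (K : SSet.{u}) (n : ℕ) (c : K _⦋n⦌ → A) :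
    coboundary A K (n + 1) (coboundary A K n c) = 0 := by
  have h : extend (coboundary A K (n + 1) (coboundary A K n c)) = 0 := by
    rw [← objD_comp_extend, ← objD_comp_extend, ← Category.assoc,
      AlgebraicTopology.AlternatingFaceMapComplex.d_squared, zero_comp]
  funext x
  rw [← extend_gen (coboundary A K (n + 1) (coboundary A K n c)) x, h]
  rfl

/-- The cocycles of a simplicial set. -/
def cocycles (A : Type u) [AddCommGroup A] (K : SSet.{u}) (n : ℕ) : AddSubgroup (K _⦋n⦌ → A) :=
  (coboundary A K n).ker

/-- The coboundaries of a simplicial set. -/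
def coboundaries (A : Type u) [AddCommGroup A] (K : SSet.{u}) (n : ℕ) :
    AddSubgroup (K _⦋n⦌ → A) :=
  match n with
  | 0 => ⊥
  | n + 1 => (coboundary A K n).range

lemma mem_cocycles {K : SSet.{u}} {n : ℕ} {c : K _⦋n⦌ → A} :
    c ∈ cocycles A K n ↔ coboundary A K n c = 0 := Iff.rfl

lemma pullback_mem_cocycles {K L : SSet.{u}} (f : K ⟶ L) {n : ℕ} {c : L _⦋n⦌ → A}
    (hc : c ∈ cocycles A L n) : pullback f n c ∈ cocycles A K n := by
  rw [mem_cocycles] at hc ⊢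
  rw [coboundary_pullback, hc, map_zero]

lemma pullback_mem_coboundaries {K L : SSet.{u}} (f : K ⟶ L) {n : ℕ} {c : L _⦋n⦌ → A}
    (hc : c ∈ coboundaries A L n) : pullback f n c ∈ coboundaries A K n := by
  cases n with
  | zero =>
    obtain rfl : c = 0 := hc
    exact zero_mem _
  | succ n =>
    obtain ⟨b, rfl⟩ := hc
    exact ⟨pullback f n b, coboundary_pullback f n b⟩

/-- Homotopic maps induce the same map on cohomology. -/
lemma pullback_sub_mem_coboundaries {K L : SSet.{u}} {f g : K ⟶ L} (H : SSet.Homotopy f g)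
    {n : ℕ} {c : L _⦋n⦌ → A} (hc : c ∈ cocycles A L n) :
    pullback f n c - pullback g n c ∈ coboundaries A K n := by
  -- On free abelian groups the simplicial homotopy becomes a chain homotopy. After composition with
  -- the cocycle c, the term containing the differential of L dies. What remains is the coboundary
  -- of c ∘ H', or 0 in degree 0.
  let H' := (H.toSimplicialObjectHomotopy.whiskerRight AddCommGrpCat.free).toChainHomotopy
  have hd : ((AlgebraicTopology.alternatingFaceMapComplex AddCommGrpCat.{u}).obj
      (freeSimplicial L)).d (n + 1) n ≫ extend c = 0 := by
    rw [AlgebraicTopology.alternatingFaceMapComplex_obj_d, objD_comp_extend,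
      mem_cocycles.mp hc]
    exact free_hom_ext fun x => extend_gen _ _
  let S := (AlgebraicTopology.alternatingFaceMapComplex AddCommGrpCat.{u}).obj (freeSimplicial K)
  let T := (AlgebraicTopology.alternatingFaceMapComplex AddCommGrpCat.{u}).obj (freeSimplicial L)
  have hp : prevD n H'.hom = H'.hom n (n + 1) ≫ T.d (n + 1) n := prevD_eq _ (by simp)
  have key : ∀ x : K _⦋n⦌, c (f.app (op ⦋n⦌) x) =
      extend c (dNext n H'.hom (gen x)) + c (g.app (op ⦋n⦌) x) := by
    intro x
    have h1 := congrArg (· ≫ extend c) (H'.comm n)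
    simp only [Preadditive.add_comp, hp, Category.assoc] at h1
    erw [hd] at h1
    rw [comp_zero, add_zero] at h1
    have h2 := ConcreteCategory.congr_hom h1 (gen x)
    have h3 : ∀ φ : K ⟶ L, extend c (((AlgebraicTopology.alternatingFaceMapComplex _).map
      (((SimplicialObject.whiskering _ _).obj AddCommGrpCat.free).map φ)).f n (gen x)) =
        c (φ.app (op ⦋n⦌) x) := by
      intro φ
      refine Eq.trans ?_ (extend_gen c _)
      exact congrArg (extend c) (FreeAbelianGroup.map_of_apply _)
    exact (h3 f).symm.trans (h2.trans (congrArg₂ (· + ·) rfl (h3 g)))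
  cases n with
  | zero =>
    have h0 : dNext 0 H'.hom = 0 := dNext_eq_zero _ _ (by simp)
    refine AddSubgroup.mem_bot.mpr (funext fun x => ?_)
    rw [Pi.sub_apply, pullback_apply, pullback_apply, key x, h0, add_sub_cancel_right]
    exact map_zero _
  | succ n =>
    have h0 : dNext (n + 1) H'.hom = S.d (n + 1) n ≫ H'.hom n (n + 1) := dNext_eq _ (by simp)
    refine ⟨fun x => extend c (H'.hom n (n + 1) (gen x)), funext fun x => ?_⟩
    let u : K _⦋n⦌ → A := fun x => extend c (H'.hom n (n + 1) (gen x))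
    have hu : H'.hom n (n + 1) ≫ extend c = extend u :=
      free_hom_ext fun x => (extend_gen u x).symm
    have hS : S.d (n + 1) n = _ := AlgebraicTopology.alternatingFaceMapComplex_obj_d _ n
    have h1 := ConcreteCategory.congr_hom (objD_comp_extend K n u) (gen x)
    rw [extend_gen, ← hu] at h1
    rw [Pi.sub_apply, pullback_apply, pullback_apply, key x, h0, add_sub_cancel_right, hS]
    exact h1.symm

end Cochains

end RackCat

namespace RackCat

open CategoryTheory Limits MonoidalCategory CartesianMonoidalCategory Opposite
open Simplicial

/-! ### Cohomology represented by a Kan complex of cocycles -/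

section Classifying

variable {A : Type u} [AddCommGroup A]

/-- The pullback of cocycles along a map of simplicial sets. -/
def pullbackCocycle {K L : SSet.{u}} (f : K ⟶ L) (n : ℕ) : cocycles A L n →+ cocycles A K n where
  toFun c := ⟨pullback f n c.1, pullback_mem_cocycles f c.2⟩
  map_zero' := rfl
  map_add' _ _ := rfl

/-- The functor of cocycles of degree `n`. -/
def cocycleFunctor (A : Type u) [AddCommGroup A] (n : ℕ) : SSet.{u}ᵒᵖ ⥤ AddCommGrpCat.{u} where
  obj K := AddCommGrpCat.of (cocycles A K.unop n)
  map f := AddCommGrpCat.ofHom (pullbackCocycle f.unop n)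

/-- The simplicial abelian group whose `m`-simplices are the cocycles of degree `n` on
`Δ[m] ⊗ L`. -/
noncomputable def cocycleSpace (A : Type u) [AddCommGroup A] (L : SSet.{u}) (n : ℕ) :
    SimplicialObject AddCommGrpCat.{u} :=
  (SSet.stdSimplex ⋙ tensorRight L).op ⋙ cocycleFunctor A n

/-- The map to the space of cocycles that corresponds to a cocycle on `K ⊗ L`. -/
noncomputable def classify {K L : SSet.{u}} {n : ℕ} (z : cocycles A (K ⊗ L) n) :
    K ⟶ underlyingOfAb (cocycleSpace A L n) where
  app m := TypeCat.ofHom fun x => pullbackCocycle (SSet.yonedaEquiv.symm x ▷ L) n z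
  naturality m m' f := by
    ext x
    refine Subtype.ext (funext fun p => ?_)
    change z.1 _ = z.1 _
    refine congrArg z.1 (Prod.ext ?_ rfl)
    exact ConcreteCategory.congr_hom (K.map_comp f (SSet.stdSimplex.objEquiv p.1).op).symm x

/-- The cochain on `K ⊗ L` that corresponds to a map to the space of cocycles. -/
noncomputable def unclassify {K L : SSet.{u}} {n : ℕ}
    (η : K ⟶ underlyingOfAb (cocycleSpace A L n)) :
    (K ⊗ L) _⦋n⦌ → A := fun p =>
  (show cocycles A (Δ[n] ⊗ L) n from η.app (op ⦋n⦌) p.1).1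
    (show (Δ[n] ⊗ L) _⦋n⦌ from (SSet.stdSimplex.objEquiv.symm (𝟙 _), p.2))

/-- By Yoneda, the tautological simplex of Δ[n] is carried to `p.1` itself. -/
lemma unclassify_classify {K L : SSet.{u}} {n : ℕ} (z : cocycles A (K ⊗ L) n) :
    unclassify (classify z) = z.1 := by
  funext p
  refine congrArg z.1 (Prod.ext ?_ rfl)
  change K.map _ p.1 = p.1
  exact ConcreteCategory.congr_hom (K.map_id _) p.1

/-- At p the coboundary involves the values of η on the faces of `p.1`. Naturality rewrites them
through the single cocycle v on Δ[n + 1] ⊗ L, and the sum is the cocycle identity of v at the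
tautological simplex. -/
lemma unclassify_mem_cocycles {K L : SSet.{u}} {n : ℕ}
    (η : K ⟶ underlyingOfAb (cocycleSpace A L n)) : unclassify η ∈ cocycles A (K ⊗ L) n := by
  rw [mem_cocycles]
  funext p
  rw [coboundary_apply]
  let v : cocycles A (Δ[n + 1] ⊗ L) n := η.app (op ⦋n + 1⦌) p.1
  have hv := congrFun (mem_cocycles.mp v.2)
    (show (Δ[n + 1] ⊗ L) _⦋n + 1⦌ from (SSet.stdSimplex.objEquiv.symm (𝟙 _), p.2))
  rw [coboundary_apply] at hv
  refine Eq.trans (Finset.sum_congr rfl fun i _ => congrArg _ ?_) hv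
  have h := SSet.δ_naturality_apply η i p.1
  refine (congrFun (congrArg Subtype.val (show (show cocycles A (Δ[n] ⊗ L) n from
    η.app (op ⦋n⦌) (K.δ i p.1)) = _ from h)) _).trans ?_
  exact congrArg v.1 (Prod.ext (SSet.stdSimplex.objEquiv.injective
    (show 𝟙 ⦋n⦌ ≫ SimplexCategory.δ i = SimplexCategory.δ i ≫ 𝟙 _ by simp)) rfl)

lemma classify_pullback {K K' L : SSet.{u}} {n : ℕ} (f : K' ⟶ K) (z : cocycles A (K ⊗ L) n) :
    f ≫ classify z = classify (pullbackCocycle (f ▷ L) n z) := by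
  ext m x
  refine Subtype.ext (funext fun p => congrArg z.1 (Prod.ext ?_ rfl))
  exact (ConcreteCategory.congr_hom (f.naturality (SSet.stdSimplex.objEquiv p.1).op) x).symm

lemma unclassify_comp {K K' L : SSet.{u}} {n : ℕ} (f : K' ⟶ K)
    (η : K ⟶ underlyingOfAb (cocycleSpace A L n)) :
    unclassify (f ≫ η) = pullback (f ▷ L) n (unclassify η) := rfl

/-- The homotopy between the inclusions of the ends of the cylinder on `K`, times `L`. -/
noncomputable def cylinderHomotopy (K L : SSet.{u}) :
    SSet.Homotopy ((SSet.ι₀ : K ⟶ K ⊗ Δ[1]) ▷ L) (SSet.ι₁ ▷ L) where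
  h := (α_ K L Δ[1]).hom ≫ K ◁ (β_ L Δ[1]).hom ≫ (α_ K Δ[1] L).inv
  h₀ := rfl
  h₁ := rfl
  -- The homotopy is relative to the empty subcomplex, so this condition is vacuous.
  rel := by
    ext d ⟨⟨_, h⟩, _⟩
    all_goals exact h.elim

/-- The homotopy is a map out of the cylinder, so it yields a cocycle on (K ⊗ Δ[1]) ⊗ L. The
restrictions of that cocycle to the two ends are cohomologous because the end inclusions are
homotopic. -/
lemma unclassify_sub_mem_of_homotopy {K L : SSet.{u}} {n : ℕ}
    {η θ : K ⟶ underlyingOfAb (cocycleSpace A L n)} (H : SSet.Homotopy η θ) :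
    unclassify η - unclassify θ ∈ coboundaries A (K ⊗ L) n := by
  have h := pullback_sub_mem_coboundaries (cylinderHomotopy K L) (unclassify_mem_cocycles H.h)
  rwa [← unclassify_comp, ← unclassify_comp, H.h₀, H.h₁] at h

/-- Homotopic maps to the space of cocycles correspond to cohomologous cocycles. -/
lemma unclassify_sub_mem {K L : SSet.{u}} {n : ℕ}
    {η θ : K ⟶ underlyingOfAb (cocycleSpace A L n)} (h : Homotopic η θ) :
    unclassify η - unclassify θ ∈ coboundaries A (K ⊗ L) n := by
  induction h with
  | rel _ _ h => exact unclassify_sub_mem_of_homotopy h.some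
  | refl => rw [sub_self]; exact zero_mem _
  | symm _ _ _ ih => rw [← neg_sub]; exact neg_mem ih
  | trans _ _ _ _ _ ih ih' => rw [← sub_add_sub_cancel]; exact add_mem ih ih'

open Classical in
/-- The extension by zero of a cochain to the cylinder. -/
noncomputable def extendToCylinder {K L : SSet.{u}} {n : ℕ} (b : (K ⊗ L) _⦋n⦌ → A) :
    ((K ⊗ Δ[1]) ⊗ L) _⦋n⦌ → A := fun p =>
  if p.1.2 = SSet.stdSimplex.const 1 0 (op ⦋n⦌) then b (p.1.1, p.2) else 0

lemma pullback_ι₀_extendToCylinder {K L : SSet.{u}} {n : ℕ} (b : (K ⊗ L) _⦋n⦌ → A) :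
    pullback (SSet.ι₀ ▷ L) n (extendToCylinder b) = b :=
  funext fun _ => if_pos rfl

lemma pullback_ι₁_extendToCylinder {K L : SSet.{u}} {n : ℕ} (b : (K ⊗ L) _⦋n⦌ → A) :
    pullback (SSet.ι₁ ▷ L) n (extendToCylinder b) = 0 :=
  funext fun _ => if_neg fun h => by
    have h0 := DFunLike.congr_fun (F := Δ[1] _⦋n⦌) h 0
    exact absurd (show (1 : Fin 2) = 0 from h0) (by decide)

/-- Cohomologous cocycles correspond to homotopic maps to the space of cocycles. -/
lemma homotopic_classify_zero {K L : SSet.{u}} {n : ℕ} (z : cocycles A (K ⊗ L) n)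
    (hz : z.1 ∈ coboundaries A (K ⊗ L) n) : Homotopic (classify z) (classify 0) := by
  cases n with
  | zero =>
    obtain rfl : z = 0 := Subtype.ext hz
    exact .refl _
  | succ n =>
    obtain ⟨b, hb⟩ := hz
    -- Extending the primitive b by zero need not give a cocycle, but its coboundary is one. It
    -- restricts to db = z at one end and to 0 at the other.
    let w : cocycles A ((K ⊗ Δ[1]) ⊗ L) (n + 1) :=
      ⟨coboundary A _ n (extendToCylinder b), coboundary_coboundary _ _ _⟩
    refine .rel _ _ ⟨?_⟩
    exact
      { h := classify w
        h₀ := by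
          refine (classify_pullback _ _).trans (congrArg classify (Subtype.ext ?_))
          change pullback _ _ (coboundary _ _ _ _) = z.1
          rw [← coboundary_pullback, pullback_ι₀_extendToCylinder, hb]
        h₁ := by
          refine (classify_pullback _ _).trans (congrArg classify (Subtype.ext ?_))
          change pullback _ _ (coboundary _ _ _ _) = 0
          rw [← coboundary_pullback, pullback_ι₁_extendToCylinder, map_zero]
        rel := by
          ext d ⟨⟨_, h⟩, _⟩
          all_goals exact h.elim }

/-- A map of simplicial sets is a cohomology equivalence if it induces an isomorphism on
cohomology with coefficients in `A`. -/
def IsCohomologyEquiv (A : Type u) [AddCommGroup A] {K L : SSet.{u}} (f : K ⟶ L) : Prop :=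
  ∀ n : ℕ, (∀ z ∈ cocycles A K n, ∃ w ∈ cocycles A L n,
      pullback f n w - z ∈ coboundaries A K n) ∧
    ∀ w ∈ cocycles A L n, pullback f n w ∈ coboundaries A K n → w ∈ coboundaries A L n

/-- This is the definition of weak equivalence tested on the Kan complex `cocycleSpace A L n`.
Surjectivity and injectivity on homotopy classes become surjectivity and injectivity on the
cohomology of the products with L. -/
theorem IsWeakEquivalence.isCohomologyEquiv_whiskerRight {K K' : SSet.{u}} {f : K ⟶ K'}
    (hf : IsWeakEquivalence f) (L : SSet.{u}) : IsCohomologyEquiv A (f ▷ L) := by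
  intro n
  obtain ⟨hf₁, hf₂⟩ := hf (underlyingOfAb (cocycleSpace A L n))
  constructor
  · intro z hz
    obtain ⟨h, hh⟩ := hf₁ (classify ⟨z, hz⟩)
    refine ⟨unclassify h, unclassify_mem_cocycles h, ?_⟩
    have := unclassify_sub_mem hh
    rwa [unclassify_classify] at this
  · intro w hw hfw
    have h1 := homotopic_classify_zero (pullbackCocycle (f ▷ L) n ⟨w, hw⟩) hfw
    -- Injectivity on homotopy classes compares maps that factor through f, so the zero map on K is
    -- factored that way.
    have h2 : classify (0 : cocycles A (K ⊗ L) n) = f ≫ classify 0 := (classify_pullback f 0).symm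
    rw [← classify_pullback, h2] at h1
    have h3 := unclassify_sub_mem (hf₂ _ _ h1)
    rw [unclassify_classify, unclassify_classify] at h3
    exact (sub_zero w) ▸ h3

lemma pullback_comp {K L M : SSet.{u}} (f : K ⟶ L) (g : L ⟶ M) (n : ℕ) (c : M _⦋n⦌ → A) :
    pullback (f ≫ g) n c = pullback f n (pullback g n c) := rfl

lemma IsCohomologyEquiv.comp {K L M : SSet.{u}} {f : K ⟶ L} {g : L ⟶ M}
    (hf : IsCohomologyEquiv A f) (hg : IsCohomologyEquiv A g) : IsCohomologyEquiv A (f ≫ g) := by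
  intro n
  constructor
  · intro z hz
    obtain ⟨w, hw, hwz⟩ := (hf n).1 z hz
    obtain ⟨v, hv, hvw⟩ := (hg n).1 w hw
    refine ⟨v, hv, ?_⟩
    have := add_mem (pullback_mem_coboundaries f hvw) hwz
    rwa [map_sub, sub_add_sub_cancel, ← pullback_comp] at this
  · intro w hw h
    exact (hg n).2 w hw ((hf n).2 _ (pullback_mem_cocycles g hw) h)

lemma isCohomologyEquiv_of_isIso {K L : SSet.{u}} (e : K ≅ L) :
    IsCohomologyEquiv A e.hom := by
  intro n
  constructor
  · intro z hz
    refine ⟨pullback e.inv n z, pullback_mem_cocycles _ hz, ?_⟩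
    rw [← pullback_comp, e.hom_inv_id]
    exact (sub_self z) ▸ zero_mem _
  · intro w hw h
    have := pullback_mem_coboundaries e.inv h
    rwa [← pullback_comp, e.inv_hom_id] at this

/-! ### Powers of a weak equivalence, and constant simplicial sets -/

/-- The `m`-th power of a simplicial set. -/
def power (m : ℕ) : SSet.{u} ⥤ SSet.{u} where
  obj K :=
    { obj d := Fin m → K.obj d
      map f := TypeCat.ofHom fun x i => K.map f (x i)
      map_id d := by
        ext x i
        exact ConcreteCategory.congr_hom (K.map_id d) (x i)
      map_comp f g := by
        ext x i
        exact ConcreteCategory.congr_hom (K.map_comp f g) (x i) }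
  map g :=
    { app d := TypeCat.ofHom fun x i => g.app d (x i)
      naturality d d' f := by
        ext x i
        exact ConcreteCategory.congr_hom (g.naturality f) (x i) }

/-- The first factor of a power, split off. -/
def powerSucc (K L : SSet.{u}) (m : ℕ) :
    (power (m + 1)).obj K ⊗ L ≅ K ⊗ ((power m).obj K ⊗ L) where
  hom := { app d := TypeCat.ofHom fun p => (p.1 0, (fun i => p.1 i.succ, p.2)) }
  inv :=
    { app d := TypeCat.ofHom fun p =>
        ((Fin.cons p.1 p.2.1 : Fin (m + 1) → K.obj d), p.2.2)
      naturality d d' f := by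
        ext p
        refine Prod.ext (funext fun i => ?_) rfl
        refine Fin.cases ?_ (fun i => ?_) i <;> rfl }
  hom_inv_id := by
    apply NatTrans.ext
    funext d
    ext p : 3
    exact Prod.ext (Fin.cons_self_tail (α := fun _ => K.obj d) p.1) rfl
  inv_hom_id := rfl

/-- The symmetry that exchanges the first two factors. -/
def swapIso (K L M : SSet.{u}) : K ⊗ (L ⊗ M) ≅ L ⊗ (K ⊗ M) where
  hom := { app d := TypeCat.ofHom fun p => (p.2.1, (p.1, p.2.2)) }
  inv := { app d := TypeCat.ofHom fun p => (p.2.1, (p.1, p.2.2)) }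

/-- The factors are replaced one at a time. The first is replaced with K^m ⊗ L as spectator; the
induction hypothesis then handles the other m with K' ⊗ L as spectator, which is why L varies in the
induction. -/
theorem IsWeakEquivalence.isCohomologyEquiv_power_whiskerRight {K K' : SSet.{u}} {f : K ⟶ K'}
    (hf : IsWeakEquivalence f) (m : ℕ) (L : SSet.{u}) :
    IsCohomologyEquiv A ((power m).map f ▷ L) := by
  induction m generalizing L with
  | zero =>
    let e : (power 0).obj K ⊗ L ≅ (power 0).obj K' ⊗ L :=
      { hom := (power 0).map f ▷ L
        inv :=
          { app d := TypeCat.ofHom fun p => (Fin.elim0, p.2)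
            naturality d d' g := by
              ext p : 3
              exact Prod.ext (Subsingleton.elim (α := Fin 0 → K.obj d') _ _) rfl }
        hom_inv_id := by
          apply NatTrans.ext
          funext d
          ext p : 3
          exact Prod.ext (Subsingleton.elim (α := Fin 0 → K.obj d) _ _) rfl
        inv_hom_id := by
          apply NatTrans.ext
          funext d
          ext p : 3
          exact Prod.ext (Subsingleton.elim (α := Fin 0 → K'.obj d) _ _) rfl }
    exact isCohomologyEquiv_of_isIso e
  | succ m ih =>
    have h : (power (m + 1)).map f ▷ L = (powerSucc K L m).hom ≫ f ▷ ((power m).obj K ⊗ L) ≫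
        (swapIso K' _ L).hom ≫ (power m).map f ▷ (K' ⊗ L) ≫
          (swapIso K' _ L).inv ≫ (powerSucc K' L m).inv := by
      rw [← Category.assoc, ← Category.assoc, ← Category.assoc, ← Category.assoc,
        Iso.eq_comp_inv]
      rfl
    rw [h]
    exact (isCohomologyEquiv_of_isIso _).comp <|
      (hf.isCohomologyEquiv_whiskerRight _).comp <|
      (isCohomologyEquiv_of_isIso _).comp <| (ih _).comp <|
      (isCohomologyEquiv_of_isIso (swapIso K' _ L).symm).comp <|
      isCohomologyEquiv_of_isIso (powerSucc K' L m).symm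

theorem IsWeakEquivalence.isCohomologyEquiv_power {K K' : SSet.{u}} {f : K ⟶ K'}
    (hf : IsWeakEquivalence f) (m : ℕ) : IsCohomologyEquiv A ((power m).map f) := by
  have h : (power m).map f = (ρ_ _).inv ≫ (power m).map f ▷ 𝟙_ SSet ≫ (ρ_ _).hom := rfl
  rw [h]
  exact (isCohomologyEquiv_of_isIso (ρ_ _).symm).comp <|
    (hf.isCohomologyEquiv_power_whiskerRight m _).comp <| isCohomologyEquiv_of_isIso (ρ_ _)

/-- The constant simplicial set. -/
abbrev constSSet (S : Type u) : SSet.{u} := (Functor.const SimplexCategoryᵒᵖ).obj S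

/-- All faces are identities, so the coboundary is an alternating sum of n + 2 copies of c. -/
lemma coboundary_constSSet {S : Type u} (m n : ℕ) (c : ((power m).obj (constSSet S)) _⦋n⦌ → A) :
    coboundary A ((power m).obj (constSSet S)) n c = if Even n then 0 else c := by
  funext x
  rw [coboundary_apply]
  have h : ∀ i, c (((power m).obj (constSSet S)).δ i x) = c x := fun i => rfl
  simp only [h, ← Finset.sum_smul, Fin.sum_neg_one_pow, Nat.even_add, even_two, iff_true]
  split_ifs
  · exact zero_smul _ _
  · exact one_smul _ _

theorem IsWeakEquivalence.mem_coboundaries {K : SSet.{u}} {S : Type u} {f : K ⟶ constSSet S}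
    (hf : IsWeakEquivalence f) (m n : ℕ) {z : ((power m).obj K) _⦋n + 1⦌ → A}
    (hz : z ∈ cocycles A ((power m).obj K) (n + 1)) :
    z ∈ (coboundary A ((power m).obj K) n).range := by
  obtain ⟨w, hw, hwz⟩ := (hf.isCohomologyEquiv_power m (n + 1)).1 z hz
  rw [mem_cocycles, coboundary_constSSet] at hw
  have h : w ∈ coboundaries A ((power m).obj (constSSet S)) (n + 1) := by
    -- In degree n + 1 a cocycle on a constant simplicial set is 0 if n is even, and is its own
    -- primitive if n is odd.
    by_cases hn : Even n
    · rw [if_neg (by simpa [Nat.even_add_one] using hn)] at hw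
      rw [show w = 0 from hw]
      exact zero_mem _
    · exact ⟨w, (coboundary_constSSet m n w).trans (if_neg hn)⟩
  have h' := sub_mem (pullback_mem_coboundaries ((power m).map f) h) hwz
  rwa [sub_sub_cancel] at h'

/-- There are no nonzero coboundaries in degree 0, so the isomorphism on cohomology gives an
equality of functions. -/
theorem IsWeakEquivalence.exists_eq_comp {K : SSet.{u}} {S : Type u} {f : K ⟶ constSSet S}
    (hf : IsWeakEquivalence f) (m : ℕ) {z : ((power m).obj K) _⦋0⦌ → A}
    (hz : z ∈ cocycles A ((power m).obj K) 0) :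
    ∃ w : (Fin m → S) → A, z = pull (fun x i => f.app (op ⦋0⦌) (x i)) w := by
  obtain ⟨w, hw, hwz⟩ := (hf.isCohomologyEquiv_power m 0).1 z hz
  exact ⟨w, (sub_eq_zero.mp hwz).symm⟩

theorem IsWeakEquivalence.eq_zero {K : SSet.{u}} {S : Type u} {f : K ⟶ constSSet S}
    (hf : IsWeakEquivalence f) (m : ℕ) {w : (Fin m → S) → A}
    (hw : pull (fun (x : Fin m → K _⦋0⦌) i => f.app (op ⦋0⦌) (x i)) w = 0) : w = 0 :=
  (hf.isCohomologyEquiv_power m 0).2 w ((coboundary_constSSet m 0 w).trans rfl) hw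

end Classifying

end RackCat

namespace RackCat

open CategoryTheory Limits MonoidalCategory CartesianMonoidalCategory Opposite
open scoped Quandles
open Simplicial

/-! ### Free racks -/

section FreeRack

variable {S : Type u}

/-- The free rack on a set `S`: the pair `(h, s)` stands for the point `h • s`. -/
def freeRackOn (S : Type u) : RackCat.{u} where
  carrier := FreeGroup S × S
  str :=
    { act := fun p q => (p.1 * FreeGroup.of p.2 * p.1⁻¹ * q.1, q.2)
      self_distrib := Prod.ext (by simp only; group) rfl
      invAct := fun p q => (p.1 * (FreeGroup.of p.2)⁻¹ * p.1⁻¹ * q.1, q.2)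
      left_inv := fun p q => Prod.ext (by simp only; group) rfl
      right_inv := fun p q => Prod.ext (by simp only; group) rfl }

/-- The generators of the free rack. -/
def freeGen (s : S) : freeRackOn S := ((1, s) : FreeGroup S × S)

/-- The action of the free group on the free rack. -/
def shift (h : FreeGroup S) (p : freeRackOn S) : freeRackOn S :=
  ((h * Prod.fst (α := FreeGroup S) p, Prod.snd (α := FreeGroup S) p) : FreeGroup S × S)

@[simp] lemma shift_one (p : freeRackOn S) : shift 1 p = p :=
  Prod.ext (one_mul _) rfl

lemma shift_mul (h k : FreeGroup S) (p : freeRackOn S) : shift (h * k) p = shift h (shift k p) :=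
  Prod.ext (mul_assoc _ _ _) rfl

lemma freeGen_act (s : S) (p : freeRackOn S) : freeGen s ◃ p = shift (FreeGroup.of s) p :=
  Prod.ext (by simp [freeGen, shift]; rfl) rfl

lemma freeGen_invAct (s : S) (p : freeRackOn S) : freeGen s ◃⁻¹ p = shift (FreeGroup.of s)⁻¹ p :=
  Prod.ext (by simp [freeGen, shift]; rfl) rfl

lemma eq_shift (p : freeRackOn S) :
    p = shift (Prod.fst (α := FreeGroup S) p) (freeGen (Prod.snd (α := FreeGroup S) p)) :=
  Prod.ext (mul_one _).symm rfl

variable {Z : RackCat.{u}}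

/-- The action of the free group on a rack that is given by points of the rack. -/
def freeAction (g : S → Z) : FreeGroup S →* Equiv.Perm Z :=
  FreeGroup.lift fun s => Rack.act' (g s)

/-- Self-distributivity makes each generator act by an automorphism, and automorphisms are closed
under products and inverses. -/
lemma freeAction_act (g : S → Z) (h : FreeGroup S) :
    ∀ a b : Z, freeAction g h (a ◃ b) = freeAction g h a ◃ freeAction g h b := by
  induction h using FreeGroup.induction_on with
  | C1 => intro a b; simp
  | of s =>
    intro a b
    simp only [freeAction, FreeGroup.lift_apply_of, Rack.act'_apply]
    exact Shelf.self_distrib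
  | inv_of s ih =>
    intro a b
    apply (freeAction g (FreeGroup.of s)).injective
    rw [ih]
    simp
  | mul x y hx hy => intro a b; simp [hx, hy]

/-- The homomorphism from the free rack with given values at the generators. -/
def freeDesc (g : S → Z) : freeRackOn S ⟶ Z :=
  mkHom (Y := freeRackOn S)
    (fun p => freeAction g (Prod.fst (α := FreeGroup S) p) (g (Prod.snd (α := FreeGroup S) p)))
    (by
      rintro ⟨h, s⟩ ⟨k, t⟩
      change freeAction g (h * FreeGroup.of s * h⁻¹ * k) (g t) = _
      have : freeAction g (FreeGroup.of s) = Rack.act' (g s) := by simp [freeAction]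
      simp [map_mul, this, Rack.act'_apply, freeAction_act])

@[simp] lemma freeDesc_freeGen (g : S → Z) (s : S) : freeDesc g (freeGen s) = g s := by
  change freeAction g 1 (g s) = g s
  simp

/-- Every point is a translate of a generator, and translation by a letter of the free group is the
rack action, or inverse action, of a generator. -/
lemma freeRackOn_hom_ext {φ ψ : freeRackOn S ⟶ Z} (h : ∀ s, φ (freeGen s) = ψ (freeGen s)) :
    φ = ψ := by
  have key : ∀ k : FreeGroup S, ∀ p, φ p = ψ p → φ (shift k p) = ψ (shift k p) := by
    intro k
    induction k using FreeGroup.induction_on with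
    | C1 => intro p hp; simpa using hp
    | of s => intro p hp; rw [← freeGen_act, map_act, map_act, hp, h]
    | inv_of s => intro p hp; rw [← freeGen_invAct, map_invAct, map_invAct, hp, h]
    | mul x y hx hy => intro p hp; rw [shift_mul]; exact hx _ (hy _ hp)
  refine hom_ext fun p => ?_
  rw [eq_shift p]
  exact key _ _ (h _)

lemma isFreeOn_range_freeGen (S : Type u) : IsFreeOn (freeRackOn S) (Set.range freeGen) := by
  intro Z g
  refine ⟨freeDesc fun s => g ⟨freeGen s, s, rfl⟩, ?_, fun ψ hψ => ?_⟩
  · rintro ⟨_, s, rfl⟩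
    exact freeDesc_freeGen _ s
  · refine freeRackOn_hom_ext fun s => ?_
    rw [freeDesc_freeGen]
    exact hψ ⟨freeGen s, s, rfl⟩

/-- A retract suffices to transfer the vanishing of cohomology from the explicit model. -/
lemma IsFreeOn.exists_retract {Y : RackCat.{u}} {B : Set Y} (h : IsFreeOn Y B) :
    Nonempty (Retract Y (freeRackOn B)) := by
  obtain ⟨i, hi, -⟩ := h (freeRackOn B) freeGen
  refine ⟨⟨i, freeDesc Subtype.val, ?_⟩⟩
  obtain ⟨j, -, hj⟩ := h Y Subtype.val
  rw [hj (𝟙 Y) fun _ => rfl]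
  refine hj _ fun b => ?_
  exact (congrArg (freeDesc Subtype.val) (hi b)).trans (freeDesc_freeGen _ b)

end FreeRack

/-! ### The rack cohomology of free racks -/

section RackCochains

variable {A : Type u} [AddCommGroup A]

/-- The differential of the rack cochains. -/
def rackCoboundary (A : Type u) [AddCommGroup A] (Y : RackCat.{u}) (n : ℕ) :
    ((Fin n → Y) → A) →+ ((Fin (n + 1) → Y) → A) :=
  ∑ j : Fin (n + 1), (-1 : ℤ) ^ ((j : ℕ) + 1) • (pull (face₀ Y j) - pull (face₁ Y j))

lemma rackCoboundary_apply (Y : RackCat.{u}) (n : ℕ) (c : (Fin n → Y) → A) (x : Fin (n + 1) → Y) :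
    rackCoboundary A Y n c x =
      ∑ j : Fin (n + 1), (-1 : ℤ) ^ ((j : ℕ) + 1) • (c (face₀ Y j x) - c (face₁ Y j x)) := by
  simp [rackCoboundary, AddMonoidHom.finsetSum_apply, Finset.sum_apply]

lemma face₀_pull {Y Z : RackCat.{u}} (φ : Y ⟶ Z) {n : ℕ} (j : Fin (n + 1)) (x : Fin (n + 1) → Y) :
    face₀ Z j (fun i => φ (x i)) = fun i => φ (face₀ Y j x i) := rfl

lemma face₁_pull {Y Z : RackCat.{u}} (φ : Y ⟶ Z) {n : ℕ} (j : Fin (n + 1)) (x : Fin (n + 1) → Y) :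
    face₁ Z j (fun i => φ (x i)) = fun i => φ (face₁ Y j x i) := by
  funext k
  simp only [face₁]
  split_ifs
  · rfl
  · exact (map_act φ _ _).symm

/-- The pullback of rack cochains along a homomorphism. -/
def rackPullback {Y Z : RackCat.{u}} (φ : Y ⟶ Z) (n : ℕ) :
    ((Fin n → Z) → A) →+ ((Fin n → Y) → A) :=
  pull fun x i => φ (x i)

lemma rackPullback_apply {Y Z : RackCat.{u}} (φ : Y ⟶ Z) (n : ℕ) (c : (Fin n → Z) → A)
    (x : Fin n → Y) : rackPullback φ n c x = c fun i => φ (x i) := rfl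

lemma rackCoboundary_rackPullback {Y Z : RackCat.{u}} (φ : Y ⟶ Z) (n : ℕ) (c : (Fin n → Z) → A) :
    rackCoboundary A Y n (rackPullback φ n c) =
      rackPullback φ (n + 1) (rackCoboundary A Z n c) := by
  funext x
  simp only [rackPullback_apply, rackCoboundary_apply, face₀_pull, face₁_pull]

lemma face₀_succ_cons (Y : RackCat.{u}) {n : ℕ} (j : Fin (n + 1)) (a : Y) (x : Fin (n + 1) → Y) :
    face₀ Y j.succ (Fin.cons a x : Fin (n + 2) → Y) =
      (Fin.cons a (face₀ Y j x) : Fin (n + 1) → Y) := by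
  funext k
  refine Fin.cases ?_ (fun k => ?_) k
  · simp [face₀]
  · simp [face₀]

lemma face₁_succ_cons (Y : RackCat.{u}) {n : ℕ} (j : Fin (n + 1)) (a : Y) (x : Fin (n + 1) → Y) :
    face₁ Y j.succ (Fin.cons a x : Fin (n + 2) → Y) =
      (Fin.cons a (face₁ Y j x) : Fin (n + 1) → Y) := by
  funext k
  refine Fin.cases ?_ (fun k => ?_) k
  · simp [face₁]
  · simp only [face₁, Fin.castSucc_succ, Fin.succ_lt_succ_iff, Fin.cons_succ]

/-- Splitting off the first index gives (dc)(a, x) = c(a ◃ x) - c(x) - (d c(a, ·))(x). The first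
difference measures the failure of c to be invariant under a, which drives the computation for free
racks. -/
lemma rackCoboundary_cons (Y : RackCat.{u}) (n : ℕ) (c : (Fin (n + 1) → Y) → A) (a : Y)
    (x : Fin (n + 1) → Y) :
    rackCoboundary A Y (n + 1) c (Fin.cons a x : Fin (n + 2) → Y) =
      c (fun i => a ◃ x i) - c x +
        ∑ j : Fin (n + 1), (-1 : ℤ) ^ (j : ℕ) •
          (c (Fin.cons a (face₀ Y j x) : Fin (n + 1) → Y) -
            c (Fin.cons a (face₁ Y j x) : Fin (n + 1) → Y)) := by
  rw [rackCoboundary_apply, Fin.sum_univ_succ]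
  congr 1
  · have h0 : face₀ Y 0 (Fin.cons a x : Fin (n + 2) → Y) = x := by
      funext k; simp [face₀]
    have h1 : face₁ Y 0 (Fin.cons a x : Fin (n + 2) → Y) = fun i => a ◃ x i := by
      funext k; simp [face₁]
    rw [h0, h1]
    simp
  · refine Finset.sum_congr rfl fun j _ => ?_
    rw [face₀_succ_cons, face₁_succ_cons, Fin.val_succ, pow_add, pow_add]
    simp

/-! ### The diagonal action of the free group and the vanishing theorem -/

variable {S : Type u}

/-- The diagonal action of the free group on the tuples of points of the free rack. -/
def shiftTuple {n : ℕ} (h : FreeGroup S) (x : Fin n → freeRackOn S) : Fin n → freeRackOn S :=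
  fun i => shift h (x i)

@[simp] lemma shiftTuple_one {n : ℕ} (x : Fin n → freeRackOn S) : shiftTuple 1 x = x :=
  funext fun _ => shift_one _

lemma shiftTuple_mul {n : ℕ} (h k : FreeGroup S) (x : Fin n → freeRackOn S) :
    shiftTuple (h * k) x = shiftTuple h (shiftTuple k x) :=
  funext fun _ => shift_mul _ _ _

/-- The action of the free group on pairs of a tuple and a value, twisted by a function. -/
def twistedAction {n : ℕ} (f : S → (Fin n → freeRackOn S) → A) :
    FreeGroup S →* Equiv.Perm ((Fin n → freeRackOn S) × A) :=
  FreeGroup.lift fun s =>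
    { toFun p := (shiftTuple (FreeGroup.of s) p.1, p.2 + f s p.1)
      invFun p := (shiftTuple (FreeGroup.of s)⁻¹ p.1,
        p.2 - f s (shiftTuple (FreeGroup.of s)⁻¹ p.1))
      left_inv p := by simp [← shiftTuple_mul]
      right_inv p := by simp [← shiftTuple_mul] }

lemma twistedAction_of {n : ℕ} (f : S → (Fin n → freeRackOn S) → A) (s : S)
    (p : (Fin n → freeRackOn S) × A) : twistedAction f (FreeGroup.of s) p =
      (shiftTuple (FreeGroup.of s) p.1, p.2 + f s p.1) := by
  simp [twistedAction]

lemma twistedAction_fst {n : ℕ} (f : S → (Fin n → freeRackOn S) → A) (h : FreeGroup S) :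
    ∀ p : (Fin n → freeRackOn S) × A, (twistedAction f h p).1 = shiftTuple h p.1 := by
  induction h using FreeGroup.induction_on with
  | C1 => intro p; simp
  | of s => intro p; rw [twistedAction_of]
  | inv_of s ih =>
    intro p
    have h := ih (twistedAction f (FreeGroup.of s)⁻¹ p)
    rw [← Equiv.Perm.mul_apply, ← map_mul, mul_inv_cancel, map_one, Equiv.Perm.one_apply] at h
    rw [h, ← shiftTuple_mul, inv_mul_cancel, shiftTuple_one]
  | mul x y hx hy => intro p; rw [map_mul, Equiv.Perm.mul_apply, hx, hy, shiftTuple_mul]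

/-- On nonempty tuples, on which the free group acts freely, a function on the generators
extends to a crossed homomorphism that is principal. -/
lemma exists_potential {n : ℕ} (f : S → (Fin (n + 1) → freeRackOn S) → A) :
    ∃ u : (Fin (n + 1) → freeRackOn S) → A,
      (∀ (s : S) (x : Fin n → freeRackOn S), u (Fin.cons (freeGen s) x) = 0) ∧
      ∀ (s : S) x, u (shiftTuple (FreeGroup.of s) x) = u x + f s x := by
  -- The group element h of the first entry trivializes the free action: h⁻¹x starts with a
  -- generator. Setting u = 0 at such tuples and transporting along h by the twisted action
  -- determines u.
  let hd (x : Fin (n + 1) → freeRackOn S) : FreeGroup S := Prod.fst (α := FreeGroup S) (x 0)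
  refine ⟨fun x => (twistedAction f (hd x) (shiftTuple (hd x)⁻¹ x, 0)).2, fun s x => ?_,
    fun s x => ?_⟩
  · change (twistedAction f 1 _).2 = 0
    simp
  · have h : hd (shiftTuple (FreeGroup.of s) x) = FreeGroup.of s * hd x := rfl
    simp only [h]
    rw [← shiftTuple_mul, mul_inv_rev, inv_mul_cancel_right, map_mul, Equiv.Perm.mul_apply,
      twistedAction_of, twistedAction_fst]
    simp only
    rw [← shiftTuple_mul, mul_inv_cancel, shiftTuple_one]

/-- The extension of a rack cochain to the rack chains. -/
def rackExtend {Y : RackCat.{u}} {n : ℕ} (c : (Fin n → Y) → A) :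
    rackChains Y n ⟶ AddCommGrpCat.of A :=
  AddCommGrpCat.ofHom (FreeAbelianGroup.lift c)

@[simp] lemma rackExtend_of {Y : RackCat.{u}} {n : ℕ} (c : (Fin n → Y) → A) (x : Fin n → Y) :
    rackExtend c (FreeAbelianGroup.of x) = c x :=
  FreeAbelianGroup.lift_apply_of _ _

lemma rackChains_hom_ext {Y : RackCat.{u}} {n : ℕ} {M : AddCommGrpCat.{u}}
    {f g : rackChains Y n ⟶ M}
    (h : ∀ x : Fin n → Y, f (FreeAbelianGroup.of x) = g (FreeAbelianGroup.of x)) : f = g :=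
  AddCommGrpCat.hom_ext (FreeAbelianGroup.lift_ext _ _ h)

lemma rackDifferential_comp_rackExtend (Y : RackCat.{u}) (n : ℕ) (c : (Fin n → Y) → A) :
    rackDifferential Y n ≫ rackExtend c = rackExtend (rackCoboundary A Y n c) := by
  refine rackChains_hom_ext fun x => ?_
  rw [rackExtend_of, rackCoboundary_apply, ConcreteCategory.comp_apply]
  have h : ∀ j, faceDiff Y j (FreeAbelianGroup.of x) =
      FreeAbelianGroup.of (face₀ Y j x) - FreeAbelianGroup.of (face₁ Y j x) := fun j => by
    simp [faceDiff]
  have hd : rackDifferential Y n (FreeAbelianGroup.of x) = ∑ j : Fin (n + 1),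
      (-1 : ℤ) ^ ((j : ℕ) + 1) •
        (FreeAbelianGroup.of (face₀ Y j x) - FreeAbelianGroup.of (face₁ Y j x)) :=
    (hom_sum_apply _ _ _).trans
      (Finset.sum_congr rfl fun j _ => congrArg (fun y => (-1 : ℤ) ^ ((j : ℕ) + 1) • y) (h j))
  rw [hd]
  refine (map_sum (FreeAbelianGroup.lift c) _ _).trans (Finset.sum_congr rfl fun j _ => ?_)
  rw [map_zsmul, map_sub, FreeAbelianGroup.lift_apply_of, FreeAbelianGroup.lift_apply_of]

lemma rackCoboundary_rackCoboundary (Y : RackCat.{u}) (n : ℕ) (c : (Fin n → Y) → A) :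
    rackCoboundary A Y (n + 1) (rackCoboundary A Y n c) = 0 := by
  have h : rackExtend (rackCoboundary A Y (n + 1) (rackCoboundary A Y n c)) = 0 := by
    rw [← rackDifferential_comp_rackExtend, ← rackDifferential_comp_rackExtend,
      ← Category.assoc, rackDifferential_comp, zero_comp]
  funext x
  rw [← rackExtend_of (rackCoboundary A Y (n + 1) (rackCoboundary A Y n c)) x, h]
  rfl

/-- Choose u with u(s·x) - u(x) = f(s, x) for all generators s, and u = 0 on tuples that start with
a generator. By `rackCoboundary_cons`, g = f - du vanishes on tuples that start with a generator.
Then dg = 0, evaluated at (s, x), says that g is invariant under the free group. Every nonempty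
tuple is a translate of one that starts with a generator, so g = 0. Since u needs nonempty tuples x,
this starts in degree 2. -/
theorem exists_rackCoboundary_of_free (S : Type u) {n : ℕ} {f : (Fin (n + 2) → freeRackOn S) → A}
    (hf : rackCoboundary A (freeRackOn S) (n + 2) f = 0) :
    ∃ u, rackCoboundary A (freeRackOn S) (n + 1) u = f := by
  obtain ⟨u, hu₀, hu⟩ := exists_potential fun s x => f (Fin.cons (freeGen s) x)
  let g := f - rackCoboundary A (freeRackOn S) (n + 1) u
  have hg : rackCoboundary A (freeRackOn S) (n + 2) g = 0 := by
    rw [map_sub, hf, rackCoboundary_rackCoboundary, sub_zero]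
  have act_eq : ∀ (s : S) {m : ℕ} (x : Fin m → freeRackOn S),
      (fun i => freeGen s ◃ x i) = shiftTuple (FreeGroup.of s) x :=
    fun s m x => funext fun i => freeGen_act s (x i)
  have hg₀ : ∀ (s : S) x, g (Fin.cons (freeGen s) x) = 0 := by
    intro s x
    change f _ - rackCoboundary A _ (n + 1) u _ = 0
    rw [rackCoboundary_cons, act_eq, hu]
    simp [hu₀]
  have hg₁ : ∀ (s : S) x, g (shiftTuple (FreeGroup.of s) x) = g x := by
    intro s x
    have h := congrFun hg (Fin.cons (freeGen s) x)
    rw [rackCoboundary_cons, act_eq] at h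
    simpa [hg₀, sub_eq_zero] using h
  have hg₂ : ∀ (h : FreeGroup S) x, g (shiftTuple h x) = g x := by
    intro h
    induction h using FreeGroup.induction_on with
    | C1 => intro x; simp
    | of s => exact hg₁ s
    | inv_of s => intro x; rw [← hg₁ s, ← shiftTuple_mul, mul_inv_cancel, shiftTuple_one]
    | mul a b ha hb => intro x; rw [shiftTuple_mul, ha, hb]
  refine ⟨u, (sub_eq_zero.mp (funext fun x => ?_)).symm⟩
  change g x = 0
  rw [← hg₂ (Prod.fst (α := FreeGroup S) (x 0))⁻¹ x, ← Fin.cons_self_tail (shiftTuple _ x)]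
  have h0 : shiftTuple (Prod.fst (α := FreeGroup S) (x 0))⁻¹ x 0 =
      freeGen (Prod.snd (α := FreeGroup S) (x 0)) := Prod.ext (inv_mul_cancel _) rfl
  rw [h0]
  exact hg₀ _ _

theorem exists_rackCoboundary_of_retract {Y Z : RackCat.{u}} (r : Retract Y Z) {n : ℕ}
    (hZ : ∀ f : (Fin (n + 2) → Z) → A, rackCoboundary A Z (n + 2) f = 0 →
      ∃ u, rackCoboundary A Z (n + 1) u = f)
    {f : (Fin (n + 2) → Y) → A} (hf : rackCoboundary A Y (n + 2) f = 0) :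
    ∃ u, rackCoboundary A Y (n + 1) u = f := by
  obtain ⟨u, hu⟩ := hZ (rackPullback r.r _ f) (by
    rw [rackCoboundary_rackPullback, hf, map_zero])
  refine ⟨rackPullback r.i _ u, ?_⟩
  rw [rackCoboundary_rackPullback, hu]
  funext x
  exact congrArg f (funext fun i => ConcreteCategory.congr_hom r.retract (x i))

theorem IsCofibrant.exists_rackCoboundary {F : SimplicialObject RackCat.{u}} (hF : IsCofibrant F)
    (q : ℕ) {n : ℕ} {f : (Fin (n + 2) → F _⦋q⦌) → A}
    (hf : rackCoboundary A (F _⦋q⦌) (n + 2) f = 0) :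
    ∃ u, rackCoboundary A (F _⦋q⦌) (n + 1) u = f := by
  obtain ⟨G, ⟨B, hB, -⟩, ⟨r⟩⟩ := hF
  refine exists_rackCoboundary_of_retract (r.map ((evaluation _ _).obj (op ⦋q⦌)))
    (fun g hg => ?_) hf
  obtain ⟨r'⟩ := (hB q).exists_retract
  exact exists_rackCoboundary_of_retract r' (fun _ h => exists_rackCoboundary_of_free _ h) hg

end RackCochains

end RackCat

namespace RackCat

open CategoryTheory Limits MonoidalCategory CartesianMonoidalCategory Opposite
open scoped Quandles
open Simplicial

/-! ### The bar resolution -/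

section Bar

/-- The functoriality of the free rack on the points of a rack. -/
def freeMap {Y Z : RackCat.{u}} (φ : Y ⟶ Z) : freeRackOn Y ⟶ freeRackOn Z :=
  freeDesc fun y => freeGen (φ y)

/-- The counit of the comonad of free racks. -/
def freeCounit (Y : RackCat.{u}) : freeRackOn Y ⟶ Y := freeDesc fun y => y

/-- The comultiplication of the comonad of free racks. -/
def freeComul (Y : RackCat.{u}) : freeRackOn Y ⟶ freeRackOn (freeRackOn Y) :=
  freeDesc fun y => freeGen (freeGen y)

variable (X : RackCat.{u})

/-- The iterates of the comonad of free racks. -/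
def iter (n : ℕ) : RackCat.{u} :=
  match n with
  | 0 => X
  | n + 1 => freeRackOn (iter n)

variable {X}

/-- The inclusion of the generators of an iterate. -/
def iterGen {n : ℕ} (y : iter X n) : iter X (n + 1) := freeGen y

/-- The counit at an iterate. -/
def iterCounit (X : RackCat.{u}) (n : ℕ) : iter X (n + 1) ⟶ iter X n := freeCounit _

/-- The comultiplication at an iterate. -/
def iterComul (X : RackCat.{u}) (n : ℕ) : iter X (n + 1) ⟶ iter X (n + 2) := freeComul _

/-- The comonad of free racks on the homomorphisms between iterates. -/
def iterLift {m n : ℕ} (φ : iter X m ⟶ iter X n) : iter X (m + 1) ⟶ iter X (n + 1) := freeMap φ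

@[simp] lemma iterLift_iterGen {m n : ℕ} (φ : iter X m ⟶ iter X n) (y : iter X m) :
    iterLift φ (iterGen y) = iterGen (φ y) := freeDesc_freeGen _ _

@[simp] lemma iterCounit_iterGen {n : ℕ} (y : iter X n) :
    iterCounit X n (iterGen y) = y := freeDesc_freeGen _ _

@[simp] lemma iterComul_iterGen {n : ℕ} (y : iter X n) :
    iterComul X n (iterGen y) = iterGen (iterGen y) := freeDesc_freeGen _ _

lemma iter_hom_ext {n : ℕ} {Z : RackCat.{u}} {φ ψ : iter X (n + 1) ⟶ Z}
    (h : ∀ y, φ (iterGen y) = ψ (iterGen y)) : φ = ψ := freeRackOn_hom_ext h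

lemma iterLift_comp {l m n : ℕ} (φ : iter X l ⟶ iter X m) (ψ : iter X m ⟶ iter X n) :
    iterLift (φ ≫ ψ) = iterLift φ ≫ iterLift ψ :=
  iter_hom_ext fun y => by simp

lemma iterLift_iterCounit {m n : ℕ} (φ : iter X m ⟶ iter X n) :
    iterLift φ ≫ iterCounit X n = iterCounit X m ≫ φ :=
  iter_hom_ext fun y => by simp

lemma iterLift_iterComul {m n : ℕ} (φ : iter X m ⟶ iter X n) :
    iterLift φ ≫ iterComul X n = iterComul X m ≫ iterLift (iterLift φ) :=
  iter_hom_ext fun y => by simp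

lemma iterComul_iterCounit (n : ℕ) :
    iterComul X n ≫ iterCounit X (n + 1) = 𝟙 _ :=
  iter_hom_ext fun y => by simp

lemma iterComul_iterLift_iterCounit (n : ℕ) :
    iterComul X n ≫ iterLift (iterCounit X n) = 𝟙 _ :=
  iter_hom_ext fun y => by simp

lemma iterComul_coassoc (n : ℕ) :
    iterComul X n ≫ iterComul X (n + 1) = iterComul X n ≫ iterLift (iterComul X n) :=
  iter_hom_ext fun y => by simp

/-! ### The simplicial structure on the iterates of the comonad -/

variable (X)

/-- The successor of a monotone map. -/
def succMap {m n : ℕ} (φ : Fin m →o Fin n) : Fin m →o Fin (n + 1) :=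
  (Fin.succOrderEmb n).toOrderHom.comp φ

/-- The restriction of a monotone map to the positive elements. -/
def tailMap {m n : ℕ} (φ : Fin (m + 1) →o Fin n) : Fin m →o Fin n :=
  φ.comp (Fin.succOrderEmb m).toOrderHom

/-- The predecessor of a monotone map that avoids `0`. -/
def predMap {m n : ℕ} (φ : Fin m →o Fin (n + 1)) (h : ∀ i, φ i ≠ 0) : Fin m →o Fin n where
  toFun i := (φ i).pred (h i)
  monotone' _ _ hij := Fin.pred_le_pred_iff.mpr (φ.monotone hij)

lemma succMap_predMap {m n : ℕ} (φ : Fin m →o Fin (n + 1)) (h : ∀ i, φ i ≠ 0) :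
    succMap (predMap φ h) = φ := by
  ext i
  exact congrArg Fin.val (Fin.succ_pred _ (h i))

lemma predMap_succMap {m n : ℕ} (φ : Fin m →o Fin n) (h : ∀ i, succMap φ i ≠ 0) :
    predMap (succMap φ) h = φ := by
  ext i
  simp [succMap, predMap]

/-- The action of monotone maps on the iterates of the comonad of free racks. -/
def iterMap {m n : ℕ} (φ : Fin m →o Fin n) : iter X n ⟶ iter X m :=
  match m, n, φ with
  | 0, 0, _ => 𝟙 _
  | 0, n + 1, φ => iterCounit X n ≫ iterMap (predMap φ fun i => i.elim0)
  | _ + 1, 0, φ => (φ 0).elim0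
  | m + 1, n + 1, φ =>
    -- Position 0 is the outermost free rack. If φ hits it, the comultiplication provides one copy
    -- to keep and one for the rest of φ; otherwise the counit removes it.
    if h : φ 0 = 0 then iterComul X n ≫ iterLift (iterMap (tailMap φ))
    else iterCounit X n ≫ iterMap (predMap φ fun i hi =>
      h (le_antisymm (hi ▸ φ.monotone (Fin.zero_le i)) (Fin.zero_le _)))
termination_by (n, m)

lemma iterMap_succMap {m n : ℕ} (φ : Fin m →o Fin n) :
    iterMap X (succMap φ) = iterCounit X n ≫ iterMap X φ := by
  cases m with
  | zero =>
    rw [iterMap, predMap_succMap]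
  | succ m => rw [iterMap, dif_neg (show ¬succMap φ 0 = 0 from Fin.succ_ne_zero _), predMap_succMap]

lemma iterMap_of_zero {m n : ℕ} (φ : Fin (m + 1) →o Fin (n + 1)) (h : φ 0 = 0) :
    iterMap X φ = iterComul X n ≫ iterLift (iterMap X (tailMap φ)) := by
  rw [iterMap, dif_pos h]

lemma exists_succMap {m n : ℕ} (φ : Fin m →o Fin (n + 1)) :
    (∃ φ' : Fin m →o Fin n, φ = succMap φ') ∨ ∃ h : 0 < m, φ ⟨0, h⟩ = 0 := by
  by_cases h : ∀ i, φ i ≠ 0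
  · exact .inl ⟨_, (succMap_predMap φ h).symm⟩
  · push Not at h
    obtain ⟨i, hi⟩ := h
    exact .inr ⟨by have := i.2; omega, le_antisymm
      ((φ.monotone (show (⟨0, _⟩ : Fin m) ≤ i from Nat.zero_le _)).trans hi.le) (Fin.zero_le _)⟩

lemma iterMap_id (n : ℕ) : iterMap X (OrderHom.id : Fin n →o Fin n) = 𝟙 _ := by
  induction n with
  | zero => rw [iterMap]
  | succ n ih =>
    have h : tailMap (OrderHom.id : Fin (n + 1) →o Fin (n + 1)) = succMap OrderHom.id := rfl
    rw [iterMap_of_zero X _ rfl, h, iterMap_succMap, ih, Category.comp_id,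
      iterComul_iterLift_iterCounit]

/-- Follow the recursion. If φ avoids 0, both sides begin with the same counit. If only φ hits 0,
naturality of the counit and a counit law cancel the comultiplication. If both hit 0, naturality of
the comultiplication and coassociativity apply. -/
lemma iterMap_comp {l m n : ℕ} (φ : Fin m →o Fin n) (ψ : Fin l →o Fin m) :
    iterMap X (φ.comp ψ) = iterMap X φ ≫ iterMap X ψ :=
  match l, m, n, φ, ψ with
  | l, m, 0, φ, ψ => by
    obtain rfl : m = 0 := by
      by_contra h
      exact (φ ⟨0, Nat.pos_of_ne_zero h⟩).elim0
    obtain rfl : φ = OrderHom.id := by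
      ext i
      exact i.elim0
    rw [iterMap_id]
    exact (Category.id_comp _).symm
  | l, m, n + 1, φ, ψ => by
    obtain ⟨φ, rfl⟩ | ⟨hm, hφ⟩ := exists_succMap φ
    · have h : (succMap φ).comp ψ = succMap (φ.comp ψ) := rfl
      rw [h, iterMap_succMap, iterMap_succMap, iterMap_comp φ ψ, Category.assoc]
    · obtain ⟨m, rfl⟩ : ∃ k, m = k + 1 := ⟨m - 1, by omega⟩
      replace hφ : φ 0 = 0 := hφ
      obtain ⟨ψ, rfl⟩ | ⟨hl, hψ⟩ := exists_succMap ψ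
      · have h : φ.comp (succMap ψ) = (tailMap φ).comp ψ := rfl
        rw [h, iterMap_comp (tailMap φ) ψ, iterMap_succMap, iterMap_of_zero X φ hφ, Category.assoc,
          reassoc_of% iterLift_iterCounit, reassoc_of% iterComul_iterCounit]
      · obtain ⟨l, rfl⟩ : ∃ k, l = k + 1 := ⟨l - 1, by omega⟩
        replace hψ : ψ 0 = 0 := hψ
        have h : tailMap (φ.comp ψ) = φ.comp (tailMap ψ) := rfl
        have h0 : φ.comp ψ 0 = 0 := (congrArg φ hψ).trans hφ
        rw [iterMap_of_zero X _ h0, h, iterMap_comp φ (tailMap ψ), iterMap_of_zero X ψ hψ,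
          iterMap_of_zero X φ hφ, iterLift_comp, iterLift_comp, Category.assoc, Category.assoc,
          reassoc_of% iterLift_iterComul, reassoc_of% iterComul_coassoc]
termination_by l + m + n
decreasing_by all_goals omega

lemma iterMap_comp_apply {l m n : ℕ} (φ : Fin m →o Fin n) (ψ : Fin l →o Fin m) (y : iter X n) :
    iterMap X (φ.comp ψ) y = iterMap X ψ (iterMap X φ y) :=
  ConcreteCategory.congr_hom (iterMap_comp X φ ψ) y

lemma iterMap_id_apply {n : ℕ} (y : iter X n) :
    iterMap X (OrderHom.id : Fin n →o Fin n) y = y :=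
  ConcreteCategory.congr_hom (iterMap_id X n) y

lemma iterMap_succMap_iterGen {m n : ℕ} (φ : Fin m →o Fin n) (y : iter X n) :
    iterMap X (succMap φ) (iterGen y) = iterMap X φ y := by
  rw [iterMap_succMap]
  simp

/-- The bar resolution of a rack by free racks. -/
def bar : SimplicialObject RackCat.{u} where
  obj d := iter X (d.unop.len + 1)
  map f := iterMap X f.unop.toOrderHom
  map_id _ := iterMap_id X _
  map_comp f g := iterMap_comp X f.unop.toOrderHom g.unop.toOrderHom

/-- The unique monotone map out of the empty set. -/
def emptyMap (n : ℕ) : Fin 0 →o Fin n := ⟨fun i => i.elim0, fun i => i.elim0⟩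

lemma eq_emptyMap {n : ℕ} (φ : Fin 0 →o Fin n) : φ = emptyMap n := by
  ext i
  exact i.elim0

/-- The augmentation of the bar resolution. -/
def barAugmentation : bar X ⟶ (SimplicialObject.const RackCat.{u}).obj X where
  app d := iterMap X (emptyMap _)
  naturality d d' f := by
    refine (iterMap_comp X _ _).symm.trans ?_
    rw [eq_emptyMap (OrderHom.comp _ _)]
    exact (Category.comp_id _).symm

lemma iterMap_iterGen {m n : ℕ} (φ : Fin (m + 1) →o Fin (n + 1)) (h : φ 0 = 0) (y : iter X n) :
    iterMap X φ (iterGen y) = iterGen (iterMap X (tailMap φ) (iterGen y)) := by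
  rw [iterMap_of_zero X φ h]
  simp

/-- Degeneracies come from monotone maps that fix 0, and these send generators to generators by
`iterMap_iterGen`. -/
lemma isFreeSimplicial_bar : IsFreeSimplicial (bar X) := by
  refine ⟨fun n => Set.range (iterGen (X := X) (n := n)), fun n => isFreeOn_range_freeGen _, ?_⟩
  rintro n i _ ⟨y, rfl⟩
  exact ⟨_, (iterMap_iterGen X (SimplexCategory.σ i).toOrderHom
    (by simp [SimplexCategory.σ]) y).symm⟩

lemma isCofibrant_bar : IsCofibrant (bar X) := ⟨_, isFreeSimplicial_bar X, ⟨Retract.refl _⟩⟩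

/-! ### The extra degeneracy and the contraction of the bar resolution -/

/-- The extension of a monotone map to a map that preserves an additional least element. -/
def consMap {m n : ℕ} (θ : Fin m →o Fin n) : Fin (m + 1) →o Fin (n + 1) where
  toFun := Fin.cons 0 fun i => (θ i).succ
  monotone' i j hij := by
    induction i using Fin.cases with
    | zero => exact Fin.zero_le _
    | succ i =>
      induction j using Fin.cases with
      | zero => exact absurd hij (by simp)
      | succ j => simpa using θ.monotone (Fin.succ_le_succ_iff.mp hij)

/-- The inclusion of generators, a map of sets only, is an extra degeneracy: it commutes with all
monotone maps up to adjoining a least element. -/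
lemma iterMap_consMap_iterGen {m n : ℕ} (θ : Fin m →o Fin n) (y : iter X n) :
    iterMap X (consMap θ) (iterGen y) = iterGen (iterMap X θ y) := by
  rw [iterMap_iterGen X _ rfl]
  have h : tailMap (consMap θ) = succMap θ := rfl
  rw [h, iterMap_succMap]
  simp

/-- The map `j ↦ j + 1` for `τ j = 1`, and `j ↦ 0` for `τ j = 0`. -/
def cutMap {n : ℕ} (τ : Fin n →o Fin 2) : Fin n →o Fin (n + 1) where
  toFun j := if τ j = 0 then 0 else j.succ
  monotone' i j hij := by
    have := τ.monotone hij
    dsimp only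
    split_ifs with h h'
    · exact le_rfl
    · exact Fin.zero_le _
    · rename_i h'
      rw [h'] at this
      exact absurd (le_antisymm this (Fin.zero_le _)) h
    · exact Fin.succ_le_succ_iff.mpr hij

lemma consMap_comp_cutMap {m n : ℕ} (τ : Fin n →o Fin 2) (θ : Fin m →o Fin n) :
    (consMap θ).comp (cutMap (τ.comp θ)) = (cutMap τ).comp θ := by
  ext j
  change (consMap θ (if τ (θ j) = 0 then 0 else j.succ) : ℕ) =
    (if τ (θ j) = 0 then 0 else (θ j).succ : Fin (n + 1))
  split_ifs <;> rfl

/-- The section of the augmentation of the bar resolution. -/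
def barSection : constSSet X ⟶ underlyingSSet.obj (bar X) where
  app d := TypeCat.ofHom fun (x : iter X 0) =>
    iterMap X (OrderHom.const (Fin (d.unop.len + 1)) (0 : Fin 1)) (iterGen x)
  naturality d d' f := by
    ext x
    exact ConcreteCategory.congr_hom (iterMap_comp X (OrderHom.const _ (0 : Fin 1))
      f.unop.toOrderHom) (iterGen (X := X) (n := 0) x)

/-- The augmentation of the bar resolution on the underlying simplicial sets. -/
def barAugmentationSSet : underlyingSSet.obj (bar X) ⟶ constSSet X :=
  underlyingSSet.map (barAugmentation X)

lemma barSection_barAugmentation : barSection X ≫ barAugmentationSSet X = 𝟙 _ := by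
  ext d x
  refine (iterMap_comp_apply X (OrderHom.const (Fin (d.unop.len + 1)) (0 : Fin 1)) (emptyMap _)
    (iterGen (X := X) (n := 0) x)).symm.trans ?_
  have h : (OrderHom.const (Fin (d.unop.len + 1)) (0 : Fin 1)).comp (emptyMap _) =
      succMap OrderHom.id := by
    ext i
    exact i.elim0
  rw [h]
  exact (iterMap_succMap_iterGen X OrderHom.id (show iter X 0 from x)).trans (iterMap_id_apply X _)

/-- The homotopy that contracts the bar resolution. -/
def barHomotopy : SSet.Homotopy (barAugmentationSSet X ≫ barSection X) (𝟙 _) where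
  h :=
    { app d := TypeCat.ofHom fun p =>
        -- Apply the extra degeneracy, then move the positions with τ = 0 to the new one. For τ = 1
        -- this returns the simplex; for τ = 0 it factors through the augmentation.
        iterMap X (cutMap (SSet.stdSimplex.objEquiv p.2).toOrderHom)
          (iterGen (show iter X (d.unop.len + 1) from p.1))
      naturality d d' f := by
        ext p
        let θ := f.unop.toOrderHom
        let τ := (SSet.stdSimplex.objEquiv p.2).toOrderHom
        let y : iter X (d.unop.len + 1) := p.1
        change iterMap X (cutMap (τ.comp θ)) (iterGen (iterMap X θ y)) =
          iterMap X θ (iterMap X (cutMap τ) (iterGen y))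
        rw [← iterMap_consMap_iterGen, ← iterMap_comp_apply, ← iterMap_comp_apply,
          consMap_comp_cutMap] }
  h₀ := by
    ext d x
    let y : iter X (d.unop.len + 1) := x
    change iterMap X (cutMap (OrderHom.const (Fin (d.unop.len + 1)) 0)) (iterGen y) =
      iterMap X (OrderHom.const (Fin (d.unop.len + 1)) (0 : Fin 1))
        (iterGen (iterMap X (emptyMap _) y))
    rw [← iterMap_consMap_iterGen, ← iterMap_comp_apply]
    rfl
  h₁ := by
    ext d x
    let y : iter X (d.unop.len + 1) := x
    change iterMap X (succMap OrderHom.id) (iterGen y) = y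
    rw [iterMap_succMap_iterGen, iterMap_id_apply]
  rel := by
    ext d ⟨⟨_, h⟩, _⟩
    all_goals exact h.elim

lemma Homotopic.postcomp {K L M : SSet.{u}} {a b : K ⟶ L} (h : Homotopic a b) (g : L ⟶ M) :
    Homotopic (a ≫ g) (b ≫ g) := by
  induction h with
  | rel a b H =>
    obtain ⟨H⟩ := H
    exact .rel _ _ ⟨{
      h := H.h ≫ g
      h₀ := by rw [← Category.assoc, H.h₀]; rfl
      h₁ := by rw [← Category.assoc, H.h₁]; rfl
      rel := by
        ext d ⟨⟨_, h⟩, _⟩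
        exact h.elim }⟩
  | refl => exact .refl _
  | symm _ _ _ ih => exact .symm _ _ ih
  | trans _ _ _ _ _ ih ih' => exact .trans _ _ _ ih ih'

lemma Homotopic.precomp {K L M : SSet.{u}} {a b : K ⟶ L} (h : Homotopic a b) (g : M ⟶ K) :
    Homotopic (g ≫ a) (g ≫ b) := by
  induction h with
  | rel a b H =>
    obtain ⟨H⟩ := H
    exact .rel _ _ ⟨{
      h := g ▷ Δ[1] ≫ H.h
      h₀ := (SSet.ι₀_comp_assoc g H.h).trans (congrArg (g ≫ ·) H.h₀)
      h₁ := (SSet.ι₁_comp_assoc g H.h).trans (congrArg (g ≫ ·) H.h₁)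
      rel := by
        ext d ⟨⟨_, h⟩, _⟩
        exact h.elim }⟩
  | refl => exact .refl _
  | symm _ _ _ ih => exact .symm _ _ ih
  | trans _ _ _ _ _ ih ih' => exact .trans _ _ _ ih ih'

/-- A deformation retraction is a weak equivalence. -/
lemma isWeakEquivalence_of_homotopic {K L : SSet.{u}} {f : K ⟶ L} {s : L ⟶ K}
    (h : s ≫ f = 𝟙 L) (H : Homotopic (f ≫ s) (𝟙 K)) : IsWeakEquivalence f := by
  intro Z _
  constructor
  · intro g
    exact ⟨s ≫ g, by simpa using H.postcomp g⟩
  · intro a b hab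
    have := hab.precomp s
    rwa [← Category.assoc, ← Category.assoc, h, Category.id_comp, Category.id_comp] at this

/-- The bar resolution as a cofibrant replacement. -/
def barReplacement : CofibrantReplacement X where
  F := bar X
  ε := barAugmentation X
  cofibrant := isCofibrant_bar X
  weakEquivalence :=
    isWeakEquivalence_of_homotopic (f := barAugmentationSSet X) (barSection_barAugmentation X)
      (.rel _ _ ⟨barHomotopy X⟩)

end Bar

end RackCat

namespace RackCat

open CategoryTheory Limits MonoidalCategory CartesianMonoidalCategory Opposite
open scoped Quandles
open Simplicial

/-! ### Subquotients and double complexes -/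

section Subquotient

/-- The quotient of a subgroup `Z` by its intersection with the subgroup `B`. -/
abbrev Subquotient {P : Type*} [AddCommGroup P] (Z B : AddSubgroup P) : Type _ :=
  Z ⧸ B.addSubgroupOf Z

/-- The homomorphism to a subquotient that is induced by a homomorphism to the subgroup. -/
def toSubquotient {W P : Type*} [AddCommGroup W] [AddCommGroup P] (α : W →+ P)
    {Z : AddSubgroup P} (B : AddSubgroup P) (h : ∀ w, α w ∈ Z) : W →+ Subquotient Z B :=
  (QuotientAddGroup.mk' _).comp (α.codRestrict Z h)

lemma toSubquotient_eq_zero_iff {W P : Type*} [AddCommGroup W] [AddCommGroup P] (α : W →+ P)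
    {Z B : AddSubgroup P} (h : ∀ w, α w ∈ Z) (w : W) :
    toSubquotient α B h w = 0 ↔ α w ∈ B :=
  (QuotientAddGroup.eq_zero_iff _).trans AddSubgroup.mem_addSubgroupOf

/-- Two subquotients are isomorphic if a group maps onto both subgroups, with the same preimage
of the subgroups that are divided out. -/
noncomputable def subquotientEquiv {W P Q : Type*} [AddCommGroup W] [AddCommGroup P]
    [AddCommGroup Q] (α : W →+ P) (β : W →+ Q) {Z B : AddSubgroup P} {Z' B' : AddSubgroup Q}
    (hα : ∀ w, α w ∈ Z) (hα' : ∀ z ∈ Z, ∃ w, α w = z)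
    (hβ : ∀ w, β w ∈ Z') (hβ' : ∀ z ∈ Z', ∃ w, β w = z)
    (h : ∀ w, α w ∈ B ↔ β w ∈ B') : Subquotient Z B ≃+ Subquotient Z' B' :=
  (QuotientAddGroup.quotientKerEquivOfSurjective (toSubquotient α B hα) (by
    rintro ⟨z⟩
    obtain ⟨w, hw⟩ := hα' z.1 z.2
    exact ⟨w, congrArg (QuotientAddGroup.mk' _) (Subtype.ext hw)⟩)).symm.trans <|
  (QuotientAddGroup.quotientAddEquivOfEq (by
    ext w
    rw [AddMonoidHom.mem_ker, AddMonoidHom.mem_ker, toSubquotient_eq_zero_iff,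
      toSubquotient_eq_zero_iff, h])).trans <|
  QuotientAddGroup.quotientKerEquivOfSurjective (toSubquotient β B' hβ) (by
    rintro ⟨z⟩
    obtain ⟨w, hw⟩ := hβ' z.1 z.2
    exact ⟨w, congrArg (QuotientAddGroup.mk' _) (Subtype.ext hw)⟩)

/-- The homology of a short complex of abelian groups as a subquotient. -/
noncomputable def homologyEquiv (S : ShortComplex AddCommGrpCat.{u}) :
    S.homology ≃+ Subquotient S.g.hom.ker S.f.hom.range :=
  S.abHomologyIso.addCommGroupIsoToAddEquiv.trans <| QuotientAddGroup.quotientAddEquivOfEq <| by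
    ext z
    rw [AddSubgroup.mem_addSubgroupOf]
    exact exists_congr fun x => Subtype.ext_iff

/-- The homology of a cochain complex in positive degrees. -/
noncomputable def homologySuccEquiv (K : CochainComplex AddCommGrpCat.{u} ℕ) (n : ℕ) :
    K.homology (n + 1) ≃+
      Subquotient (K.d (n + 1) (n + 2)).hom.ker (K.d n (n + 1)).hom.range :=
  (ShortComplex.homologyMapIso (K.isoSc' n (n + 1) (n + 2) (by simp) (by simp)))
    |>.addCommGroupIsoToAddEquiv.trans (homologyEquiv _)

/-- The homology of a cochain complex in degree `0`. -/
noncomputable def homologyZeroEquiv (K : CochainComplex AddCommGrpCat.{u} ℕ) :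
    K.homology 0 ≃+ Subquotient (K.d 0 1).hom.ker ⊥ :=
  -- The index 0 counts as its own predecessor, and the differential from 0 to 0 is zero.
  (ShortComplex.homologyMapIso (K.isoSc' 0 0 1 (by simp) (by simp)))
    |>.addCommGroupIsoToAddEquiv.trans <| (homologyEquiv _).trans <|
      subquotientEquiv (W := (K.d 0 1).hom.ker) (AddSubgroup.subtype _) (AddSubgroup.subtype _)
        (fun w => w.2) (fun z hz => ⟨⟨z, hz⟩, rfl⟩) (fun w => w.2) (fun z hz => ⟨⟨z, hz⟩, rfl⟩)
        fun w => by
          have h : (K.d 0 0).hom.range = ⊥ := by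
            rw [K.shape 0 0 (by simp)]
            exact AddMonoidHom.range_zero
          exact iff_of_eq (congrArg (fun B : AddSubgroup (K.X 0) => w.1 ∈ B) h)

section Comparison

variable (K : CochainComplex AddCommGrpCat.{u} ℕ) {P : ℕ → Type u} [∀ n, AddCommGroup (P n)]
  (e : ∀ n, P n →+ P (n + 1)) (θ : ∀ n, K.X n →+ P n)

/-- The homology in degree `0` of a cochain complex that embeds into a sequence of groups. -/
theorem nonempty_homologyZeroEquiv
    (hθ : ∀ n, Function.Injective (θ n))
    {Z : ∀ n, AddSubgroup (P n)} (hZ : ∀ n, (θ n).range = Z n)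
    (comm : ∀ n x, θ (n + 1) ((K.d n (n + 1)).hom x) = e n (θ n x)) :
    Nonempty (K.homology 0 ≃+ Subquotient (Z 0 ⊓ (e 0).ker) ⊥) := by
  obtain rfl : (fun n => (θ n).range) = Z := funext hZ
  exact ⟨(homologyZeroEquiv K).trans <| subquotientEquiv (W := (K.d 0 1).hom.ker)
    (AddSubgroup.subtype _) ((θ 0).comp (AddSubgroup.subtype _))
    (fun w => w.2) (fun z hz => ⟨⟨z, hz⟩, rfl⟩)
    (fun w => ⟨⟨w.1, rfl⟩, (comm 0 w.1).symm.trans ((congrArg _ w.2).trans (map_zero _))⟩)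
    (by
      rintro _ ⟨⟨x, rfl⟩, hx⟩
      exact ⟨⟨x, hθ 1 (((comm 0 x).trans hx).trans (map_zero _).symm)⟩, rfl⟩)
    (fun w => (map_eq_zero_iff _ (hθ 0)).symm)⟩

/-- The homology in positive degrees of a cochain complex that embeds into a sequence of groups. -/
theorem nonempty_homologySuccEquiv
    (hθ : ∀ n, Function.Injective (θ n))
    {Z : ∀ n, AddSubgroup (P n)} (hZ : ∀ n, (θ n).range = Z n)
    (comm : ∀ n x, θ (n + 1) ((K.d n (n + 1)).hom x) = e n (θ n x)) (n : ℕ) :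
    Nonempty (K.homology (n + 1) ≃+
      Subquotient (Z (n + 1) ⊓ (e (n + 1)).ker) ((Z n).map (e n))) := by
  obtain rfl : (fun n => (θ n).range) = Z := funext hZ
  exact ⟨(homologySuccEquiv K n).trans <| subquotientEquiv (W := (K.d (n + 1) (n + 2)).hom.ker)
    (AddSubgroup.subtype _) ((θ (n + 1)).comp (AddSubgroup.subtype _))
    (fun w => w.2) (fun z hz => ⟨⟨z, hz⟩, rfl⟩)
    (fun w => ⟨⟨w.1, rfl⟩, (comm (n + 1) w.1).symm.trans ((congrArg _ w.2).trans (map_zero _))⟩)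
    (by
      rintro _ ⟨⟨x, rfl⟩, hx⟩
      exact ⟨⟨x, hθ _ (((comm _ x).trans hx).trans (map_zero _).symm)⟩, rfl⟩)
    (by
      rintro ⟨w, hw⟩
      constructor
      · rintro ⟨x, rfl⟩
        exact ⟨θ n x, ⟨x, rfl⟩, (comm n x).symm⟩
      · rintro ⟨_, ⟨x, rfl⟩, hx⟩
        exact ⟨x, hθ _ ((comm n x).trans hx)⟩)⟩

end Comparison

end Subquotient

/-! ### Zigzags in a double complex with exact rows and columns -/

section DoubleComplex

variable {C : ℕ → ℕ → Type u} [∀ p q, AddCommGroup (C p q)]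
  (dh : ∀ p q, C p q →+ C (p + 1) q) (dv : ∀ p q, C p q →+ C p (q + 1))

/-- The elements of a double complex that are cocycles in both directions. -/
def biCocycles (p q : ℕ) : AddSubgroup (C p q) := (dh p q).ker ⊓ (dv p q).ker

/-- The vertical coboundaries of horizontal cocycles. -/
def verticalCoboundaries (p q : ℕ) : AddSubgroup (C p (q + 1)) := (dh p q).ker.map (dv p q)

/-- The horizontal coboundaries of vertical cocycles. -/
def horizontalCoboundaries (p q : ℕ) : AddSubgroup (C (p + 1) q) := (dv p q).ker.map (dh p q)

/-- The dimension shift in a double complex with exact rows and columns. -/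
noncomputable def dimensionShift
    (comm : ∀ p q c, dv (p + 1) q (dh p q c) = dh p (q + 1) (dv p q c))
    (hh : ∀ p q c, dh (p + 1) q (dh p q c) = 0) (vv : ∀ p q c, dv p (q + 1) (dv p q c) = 0)
    (exh : ∀ p q c, dh (p + 1) q c = 0 → ∃ b, dh p q b = c)
    (exv : ∀ p q c, dv p (q + 1) c = 0 → ∃ b, dv p q b = c) (p q : ℕ) :
    Subquotient (biCocycles dh dv p (q + 1)) (verticalCoboundaries dh dv p q) ≃+
      Subquotient (biCocycles dh dv (p + 1) q) (horizontalCoboundaries dh dv p q) :=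
  -- Both sides are quotients of the group of b with dv(dh b) = 0, by b ↦ dv b and b ↦ dh b;
  -- exactness gives surjectivity. Both kernels are ker dh + ker dv.
  subquotientEquiv (W := ((dv (p + 1) q).comp (dh p q)).ker)
    ((dv p q).comp (AddSubgroup.subtype _)) ((dh p q).comp (AddSubgroup.subtype _))
    (fun w => ⟨(comm p q w.1).symm.trans w.2, vv p q _⟩)
    (fun z hz => by
      obtain ⟨b, rfl⟩ := exv p q z hz.2
      exact ⟨⟨b, (comm p q b).trans hz.1⟩, rfl⟩)
    (fun w => ⟨hh p q _, w.2⟩)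
    (fun z hz => by
      obtain ⟨b, rfl⟩ := exh p q z hz.1
      exact ⟨⟨b, hz.2⟩, rfl⟩)
    (by
      rintro ⟨w, -⟩
      constructor
      · rintro ⟨c, hc, hcw⟩
        refine ⟨w - c, ?_, ?_⟩
        · rw [SetLike.mem_coe, AddMonoidHom.mem_ker, map_sub, sub_eq_zero]
          exact hcw.symm
        · rw [map_sub, show dh p q c = 0 from hc, sub_zero]
          rfl
      · rintro ⟨c, hc, hcw⟩
        refine ⟨w - c, ?_, ?_⟩
        · rw [SetLike.mem_coe, AddMonoidHom.mem_ker, map_sub, sub_eq_zero]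
          exact hcw.symm
        · rw [map_sub, show dv p q c = 0 from hc, sub_zero]
          rfl)

/-- By exactness both groups are the image of dv ∘ dh from position (p, q). This makes the target of
one dimension shift the source of the next. -/
lemma horizontalCoboundaries_eq
    (comm : ∀ p q c, dv (p + 1) q (dh p q c) = dh p (q + 1) (dv p q c))
    (hh : ∀ p q c, dh (p + 1) q (dh p q c) = 0) (vv : ∀ p q c, dv p (q + 1) (dv p q c) = 0)
    (exh : ∀ p q c, dh (p + 1) q c = 0 → ∃ b, dh p q b = c)
    (exv : ∀ p q c, dv p (q + 1) c = 0 → ∃ b, dv p q b = c) (p q : ℕ) :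
    horizontalCoboundaries dh dv p (q + 1) = verticalCoboundaries dh dv (p + 1) q := by
  ext z
  constructor
  · rintro ⟨c, hc, rfl⟩
    obtain ⟨b, rfl⟩ := exv p q c hc
    exact ⟨dh p q b, hh p q b, comm p q b⟩
  · rintro ⟨c, hc, rfl⟩
    obtain ⟨b, rfl⟩ := exh p q c hc
    exact ⟨dv p q b, vv p q b, (comm p q b).symm⟩

/-- The comparison of the two edges of a double complex with exact rows and columns. -/
theorem nonempty_edgeEquiv
    (comm : ∀ p q c, dv (p + 1) q (dh p q c) = dh p (q + 1) (dv p q c))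
    (hh : ∀ p q c, dh (p + 1) q (dh p q c) = 0) (vv : ∀ p q c, dv p (q + 1) (dv p q c) = 0)
    (exh : ∀ p q c, dh (p + 1) q c = 0 → ∃ b, dh p q b = c)
    (exv : ∀ p q c, dv p (q + 1) c = 0 → ∃ b, dv p q b = c) (n p k : ℕ) (hk : p + n = k) :
    Nonempty (Subquotient (biCocycles dh dv p (n + 1)) (verticalCoboundaries dh dv p n) ≃+
      Subquotient (biCocycles dh dv (k + 1) 0) (horizontalCoboundaries dh dv k 0)) := by
  -- The name k for p + n keeps the type of the target fixed while p moves along the antidiagonal.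
  induction n generalizing p with
  | zero =>
    obtain rfl : p = k := hk
    exact ⟨dimensionShift dh dv comm hh vv exh exv p 0⟩
  | succ n ih =>
    obtain ⟨e⟩ := ih (p + 1) (by omega)
    rw [← horizontalCoboundaries_eq dh dv comm hh vv exh exv] at e
    exact ⟨(dimensionShift dh dv comm hh vv exh exv p (n + 1)).trans e⟩

end DoubleComplex

end RackCat

namespace RackCat

open CategoryTheory Limits MonoidalCategory CartesianMonoidalCategory Opposite
open scoped Quandles
open Simplicial

section Comparison

variable {X : RackCat.{u}} (A : Type u) [AddCommGroup A]

/-! ### The cochains of a cofibrant replacement -/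

/-- The cochain on a rack over `X` that belongs to a morphism from the free Beck module to the
trivial Beck module. -/
def quillenCochain (Y : Over X) :
    (homFunctor (trivialBeckModule A X)).obj (op (freeBeckModule Y)) →+ ((Fin 1 → Y.left) → A) where
  toFun g x := Prod.fst (α := A) ((freeUnit Y ≫ (Additive.toMul g).hom.hom).left (x 0))
  map_zero' := rfl
  map_add' _ _ := rfl

/-- By the adjunction, g is determined by a morphism from Y to A × X over X, whose component in X is
prescribed. -/
lemma quillenCochain_injective (Y : Over X) : Function.Injective (quillenCochain A Y) := by
  intro g g' h
  have key : (InducedCategory.homMk (Additive.toMul g) :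
      freeBeckModule Y ⟶ trivialBeckModule A X) = (InducedCategory.homMk (Additive.toMul g') :
        freeBeckModule Y ⟶ trivialBeckModule A X) := by
    refine (freeEquiv Y _).injective (over_ext fun y => ?_)
    have hw : ∀ f : Y ⟶ (trivialBeckModule A X).X,
        Prod.snd (α := A) (β := X) (f.left y) = Y.hom y := fun f => over_w f y
    exact Prod.ext (congrFun h fun _ => y) ((hw _).trans (hw _).symm)
  exact congrArg (fun f : freeBeckModule Y ⟶ trivialBeckModule A X => f.hom) key

/-- Both faces of a 1-tuple are the empty tuple, so only the first difference in
`rackCoboundary_cons` survives. -/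
lemma mem_ker_rackCoboundary_one (Y : RackCat.{u}) (c : (Fin 1 → Y) → A) :
    rackCoboundary A Y 1 c = 0 ↔ ∀ a b : Y, c (fun _ => a ◃ b) = c fun _ => b := by
  have h : ∀ (a : Y) x, rackCoboundary A Y 1 c (Fin.cons a x : Fin 2 → Y) =
      c (fun i => a ◃ x i) - c x := by
    intro a x
    rw [rackCoboundary_cons, Fin.sum_univ_one, add_eq_left]
    have : (Fin.cons a (face₀ Y 0 x) : Fin 1 → Y) = Fin.cons a (face₁ Y 0 x) :=
      congrArg (Fin.cons (α := fun _ => Y) a) (Subsingleton.elim _ _)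
    rw [this, sub_self, smul_zero]
  constructor
  · intro hc a b
    rw [← sub_eq_zero, ← h a fun _ => b, hc]
    rfl
  · intro hc
    funext x
    rw [← Fin.cons_self_tail x, h]
    refine sub_eq_zero.mpr ?_
    have hx : Fin.tail x = fun _ => x 1 := funext fun i => by
      rw [Subsingleton.elim i 0]
      rfl
    rw [hx]
    exact hc _ _

/-- The map y ↦ (c(y), y's image in X) respects the operation exactly when c(a ◃ b) = c(b), because
A carries the trivial operation. -/
lemma range_quillenCochain (Y : Over X) :
    (quillenCochain A Y).range = (rackCoboundary A Y.left 1).ker := by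
  ext c
  rw [AddMonoidHom.mem_ker, mem_ker_rackCoboundary_one]
  constructor
  · rintro ⟨g, rfl⟩ a b
    let f := freeUnit Y ≫ (Additive.toMul g).hom.hom
    exact (congrArg (Prod.fst (α := A) (β := X)) (map_act f.left a b)).trans rfl
  · intro hc
    let f : Y ⟶ (trivialBeckModule A X).X :=
      mkOverHom (fun y => ((c fun _ => y, Y.hom y) : A × X))
        (fun a b => Prod.ext (hc a b) (map_act Y.hom a b)) fun _ => rfl
    refine ⟨Additive.ofMul (freeLift f).hom, funext fun x => ?_⟩
    refine Eq.trans (b := c fun _ => x 0) rfl (congrArg c (funext fun i => ?_))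
    rw [Subsingleton.elim i 0]

/-! ### The double complex of a cofibrant replacement and its edges -/

variable (R : CofibrantReplacement X)

/-- The differential of the cochains on the powers of a cofibrant replacement. -/
def simplicialCoboundary (p q : ℕ) : ((Fin p → R.F _⦋q⦌) → A) →+ ((Fin p → R.F _⦋q + 1⦌) → A) :=
  coboundary A ((power p).obj (underlyingSSet.obj R.F)) q

lemma simplicialCoboundary_apply (p q : ℕ) (c) (x) :
    simplicialCoboundary A R p q c x =
      ∑ i : Fin (q + 2), (-1 : ℤ) ^ (i : ℕ) • rackPullback (R.F.δ i) p c x :=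
  coboundary_apply _ _ _ _

lemma simplicialCoboundary_rackCoboundary (p q : ℕ) (c : (Fin p → R.F _⦋q⦌) → A) :
    simplicialCoboundary A R (p + 1) q (rackCoboundary A (R.F _⦋q⦌) p c) =
      rackCoboundary A (R.F _⦋q + 1⦌) p (simplicialCoboundary A R p q c) := by
  have h : ∀ p, simplicialCoboundary A R p q =
      ∑ i : Fin (q + 2), (-1 : ℤ) ^ (i : ℕ) • rackPullback (R.F.δ i) p := fun p => rfl
  rw [h, h, AddMonoidHom.finsetSum_apply, AddMonoidHom.finsetSum_apply, map_sum]
  refine Finset.sum_congr rfl fun i _ => ?_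
  rw [AddMonoidHom.zsmul_apply, AddMonoidHom.zsmul_apply, map_zsmul, rackCoboundary_rackPullback]

/-- The cochain on the vertices of a cofibrant replacement that belongs to a homomorphism from the
rack chains. -/
noncomputable def rackCochain (n : ℕ) :
    (homComplex (rackComplex X) (AddCommGrpCat.of A)).X n →+ ((Fin n → R.F _⦋0⦌) → A) where
  toFun g x := g.hom (FreeAbelianGroup.of fun i => R.ε.app (op ⦋0⦌) (x i))
  map_zero' := rfl
  map_add' _ _ := rfl

lemma rackCochain_injective (n : ℕ) : Function.Injective (rackCochain A R n) := by
  refine (injective_iff_map_eq_zero _).mpr fun g hg => ?_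
  have := R.weakEquivalence.eq_zero (A := A) (S := X) n
    (w := fun x => g.hom (FreeAbelianGroup.of x)) hg
  exact rackChains_hom_ext fun x => congrFun this x

/-- A function on F_0^n that is a simplicial cocycle descends uniquely to X^n, by the isomorphism on
cohomology in degree 0. -/
lemma range_rackCochain (n : ℕ) :
    (rackCochain A R n).range = (simplicialCoboundary A R n 0).ker := by
  ext z
  constructor
  · rintro ⟨g, rfl⟩
    exact pullback_mem_cocycles ((power n).map (underlyingSSet.map R.ε))
      (c := fun x : Fin n → X => g.hom (FreeAbelianGroup.of x))
      ((coboundary_constSSet n 0 _).trans rfl)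
  · intro hz
    obtain ⟨w, rfl⟩ := R.weakEquivalence.exists_eq_comp (A := A) (S := X) n hz
    refine ⟨rackExtend w, funext fun x => ?_⟩
    exact rackExtend_of w _

lemma rackCochain_d (n : ℕ) (g) :
    rackCochain A R (n + 1)
        (((homComplex (rackComplex X) (AddCommGrpCat.of A)).d n (n + 1)).hom g) =
      rackCoboundary A (R.F _⦋0⦌) n (rackCochain A R n g) := by
  obtain ⟨w, rfl⟩ : ∃ w : (Fin n → X) → A, rackExtend w = g :=
    ⟨fun x => g.hom (FreeAbelianGroup.of x), rackChains_hom_ext fun x => rackExtend_of _ x⟩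
  have h : ((homComplex (rackComplex X) (AddCommGrpCat.of A)).d n (n + 1)).hom (rackExtend w) =
      rackExtend (rackCoboundary A X n w) := by
    have hd : (homComplex (rackComplex X) (AddCommGrpCat.of A)).d n (n + 1) =
        AddCommGrpCat.ofHom (Preadditive.leftComp _ ((rackComplex X).d (n + 1) n)) :=
      CochainComplex.of_d (fun n => AddCommGrpCat.of ((rackComplex X).X n ⟶ AddCommGrpCat.of A))
        (fun n => AddCommGrpCat.ofHom (Preadditive.leftComp _ ((rackComplex X).d (n + 1) n))) n
    rw [hd]
    refine Eq.trans ?_ (rackDifferential_comp_rackExtend X n w)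
    exact congrArg (· ≫ rackExtend w) (ChainComplex.of_d _ _ _)
  have hw : ∀ m (v : (Fin m → X) → A),
      rackCochain A R m (rackExtend v) = rackPullback (R.ε.app (op ⦋0⦌)) m v :=
    fun m v => funext fun x => rackExtend_of v _
  rw [h, hw, hw]
  exact (rackCoboundary_rackPullback _ _ _).symm


/-- The cochain complex of the Quillen cohomology. -/
noncomputable abbrev quillenComplex : CochainComplex AddCommGrpCat.{u} ℕ :=
  (AlgebraicTopology.alternatingCofaceMapComplex AddCommGrpCat.{u}).obj
    (R.cotangentComplex.rightOp ⋙ homFunctor (trivialBeckModule A X))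

lemma quillenCochain_d (q : ℕ) (g : (quillenComplex A R).X q) :
    quillenCochain A (R.slice _⦋q + 1⦌) (((quillenComplex A R).d q (q + 1)).hom g) =
      simplicialCoboundary A R 1 q (quillenCochain A (R.slice _⦋q⦌) g) := by
  have h : (quillenComplex A R).d q (q + 1) = ∑ i : Fin (q + 2), (-1 : ℤ) ^ (i : ℕ) •
      (homFunctor (trivialBeckModule A X)).map ((abelianization X).map (R.slice.δ i)).op :=
    CochainComplex.of_d (fun n => (R.cotangentComplex.rightOp ⋙
      homFunctor (trivialBeckModule A X)).obj ⦋n⦌)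
      (AlgebraicTopology.AlternatingCofaceMapComplex.objD _) q
  rw [h]
  refine (congrArg (quillenCochain A (R.slice _⦋q + 1⦌)) (hom_sum_apply _ _ _)).trans ?_
  refine (map_sum (quillenCochain A (R.slice _⦋q + 1⦌)) _ _).trans ?_
  funext x
  refine (Finset.sum_apply _ _ _).trans (Eq.trans ?_ (simplicialCoboundary_apply A R 1 q _ x).symm)
  refine Finset.sum_congr rfl fun i _ => ?_
  exact congrFun (map_zsmul (quillenCochain A (R.slice _⦋q + 1⦌)) _ _) x

/-- The rack cohomology and the Quillen cohomology of a rack with trivial coefficients. -/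
theorem nonempty_rackCohomology_equiv (n : ℕ) :
    Nonempty (rackCohomology X A (n + 1) ≃+
      quillenCohomology R (trivialBeckModule A X) n) := by
  obtain ⟨e₁⟩ := nonempty_homologySuccEquiv (homComplex (rackComplex X) (AddCommGrpCat.of A))
    (fun n => rackCoboundary A (R.F _⦋0⦌) n) (rackCochain A R) (rackCochain_injective A R)
    (range_rackCochain A R)     (rackCochain_d A R) n
  cases n with
  | zero =>
    obtain ⟨e₂⟩ := nonempty_homologyZeroEquiv (quillenComplex A R)
      (fun q => simplicialCoboundary A R 1 q) (fun q => quillenCochain A (R.slice _⦋q⦌))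
      (fun q => quillenCochain_injective A _)
      (fun q => range_quillenCochain A _) (quillenCochain_d A R)
    -- For n = 0 no shift is needed: both sides are the bicocycles in Map(F_0, A), since rack
    -- 1-coboundaries vanish.
    have h : rackCoboundary A (R.F _⦋0⦌) 0 = 0 := by
      refine AddMonoidHom.ext fun c => funext fun x => ?_
      rw [rackCoboundary_apply, Fin.sum_univ_one, Subsingleton.elim (face₀ _ 0 x) (face₁ _ 0 x),
        sub_self, smul_zero]
      rfl
    rw [h, inf_comm] at e₁
    have h' : (simplicialCoboundary A R 0 0).ker.map
        (0 : ((Fin 0 → R.F _⦋0⦌) → A) →+ ((Fin 1 → R.F _⦋0⦌) → A)) = ⊥ := by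
      rw [eq_bot_iff]
      rintro _ ⟨x, -, rfl⟩
      rfl
    rw [h'] at e₁
    exact ⟨e₁.trans e₂.symm⟩
  | succ n =>
    obtain ⟨e₂⟩ := nonempty_homologySuccEquiv (quillenComplex A R)
      (fun q => simplicialCoboundary A R 1 q) (fun q => quillenCochain A (R.slice _⦋q⦌))
      (fun q => quillenCochain_injective A _)
      (fun q => range_quillenCochain A _) (quillenCochain_d A R) n
    -- The column index p stands for tuples of length p + 1. Empty tuples are left out, and the rows
    -- are exact from length 2 on.
    obtain ⟨e⟩ := nonempty_edgeEquiv (C := fun p q => (Fin (p + 1) → R.F _⦋q⦌) → A)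
      (fun p q => rackCoboundary A (R.F _⦋q⦌) (p + 1))
      (fun p q => simplicialCoboundary A R (p + 1) q)
      (fun p q => simplicialCoboundary_rackCoboundary A R (p + 1) q)
      (fun p q => rackCoboundary_rackCoboundary _ _)
      (fun p q => coboundary_coboundary ((power (p + 1)).obj (underlyingSSet.obj R.F)) q)
      (fun p q c => R.cofibrant.exists_rackCoboundary q)
      (fun p q c hc => R.weakEquivalence.mem_coboundaries (S := X) (p + 1) q hc)
      n 0 n (Nat.zero_add n)
    rw [inf_comm] at e₁
    exact ⟨e₁.trans (e.symm.trans e₂.symm)⟩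

end Comparison

end RackCat

theorem theorem3p1 (X : Type u) [Rack X] (A : Type u) [AddCommGroup A] :
    Nonempty (RackCat.CofibrantReplacement (RackCat.of X)) ∧
    ∀ (R : RackCat.CofibrantReplacement (RackCat.of X)) (n : ℕ),
      Nonempty (RackCat.rackCohomology (RackCat.of X) A (n + 1) ≃+
        RackCat.quillenCohomology R (RackCat.trivialBeckModule A (RackCat.of X)) n) :=
  ⟨⟨RackCat.barReplacement _⟩, fun R n => RackCat.nonempty_rackCohomology_equiv A R n⟩
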